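/- Let $B_n$ denote the Boolean lattice of all subsets of $[n]=\{1,\dots,n\}$, ordered by inclusion. For $\mathcal F\subseteq B_n$ the Lubell mass of $\mathcal F$ is $\lambda_n(\mathcal F)=\sum_{S\in\mathcal F}\binom{n}{|S|}^{-1}$. A $k$-coloring of $B_n$ is a map $\phi:B_n\to[k]$; a partial $k$-coloring is a map from some subset of $B_n$ to $[k]$; the color classes are the sets $\phi^{-1}(i)$, $i\in[k]$. A (partial) $k$-coloring admits a strong rainbow copy of $A_k$ if there are $k$ pairwise incomparable (with respect to inclusion) sets in $B_n$ that are all colored, with pairwise different colors. Let $F(n,k)$ be the smallest integer $m\ge 0$ such that every $k$-coloring of $B_n$ all of whose color classes have size at least $m$ admits a strong rainbow copy of $A_k$. Let $G(n,k)$ be the infimum of all real $\gamma$ such that every $k$-coloring of $B_n$ all of whose color classes have Lubell mass at least $\gamma$ admits a strong rainbow copy of $A_k$. Let $F'(n,k)$ and $G'(n,k)$ be defined in the same way as $F(n,k)$ and $G(n,k)$, respectively, with partial $k$-colorings in place of $k$-colorings. Theorem 4.6. (i) For every $n\ge 18$, $F(n,3)=F'(n,2)$. (ii) The limits $\lim_{n\to\infty}G(n,3)$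 and $\lim_{n\to\infty}G'(n,2)$ exist, and $\lim_{n\to\infty}G(n,3)=\lim_{n\to\infty}G'(n,2)=1+\sqrt2$. -/

import Mathlib

namespace RainbowBoolean

/-- The Boolean lattice `B_n`: all subsets of an `n`-element set, ordered by inclusion. -/
abbrev B (n : ℕ) : Type := Finset (Fin n)

/-- The antichain poset `A_k`: `k` pairwise incomparable elements. -/
structure A (k : ℕ) where
  val : Fin k

instance instPartialOrderA (k : ℕ) : PartialOrder (A k) where
  le a b := a = b
  le_refl _ := rfl
  le_trans _ _ _ h₁ h₂ := Eq.trans h₁ h₂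
  le_antisymm _ _ h _ := h

/-- `X ⊆ Q` is a strong (induced) copy of `P`: there is a bijection `α : P → X` such that
`p ≤ p'` if and only if `α p ≤ α p'`. -/
def IsStrongCopy (P : Type*) [PartialOrder P] {Q : Type*} [PartialOrder Q] (X : Set Q) : Prop :=
  ∃ α : P ≃ X, ∀ p q : P, p ≤ q ↔ (α p : Q) ≤ (α q : Q)

/-- A partial `k`-coloring of `B_n`; the value `none` means that the set is not colored. -/
abbrev PartialColoring (n k : ℕ) : Type := B n → Option (Fin k)

/-- A `k`-coloring of `B_n`. -/
abbrev Coloring (n k : ℕ) : Type := B n → Fin k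

/-- A coloring is a partial coloring that colors every set. -/
def Coloring.toPartial {n k : ℕ} (φ : Coloring n k) : PartialColoring n k :=
  fun S => some (φ S)

/-- The color class of color `i`. -/
def colorClass {n k : ℕ} (φ : PartialColoring n k) (i : Fin k) : Finset (B n) :=
  Finset.univ.filter (fun S => φ S = some i)

/-- `X` is rainbow: all its members are colored, with pairwise different colors. -/
def IsRainbow {n k : ℕ} (φ : PartialColoring n k) (X : Set (B n)) : Prop :=
  (∀ S ∈ X, φ S ≠ none) ∧ ∀ S ∈ X, ∀ T ∈ X, S ≠ T → φ S ≠ φ T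

/-- The partial `k`-coloring `φ` of `B_n` admits a strong rainbow copy of `A_k`. -/
def HasStrongRainbowAntichain {n k : ℕ} (φ : PartialColoring n k) : Prop :=
  ∃ X : Set (B n), IsStrongCopy (A k) X ∧ IsRainbow φ X

/-- The Lubell mass `λ_n(𝓕) = ∑_{S ∈ 𝓕} 1 / binom(n, |S|)`. -/
noncomputable def lubellMass {n : ℕ} (𝓕 : Finset (B n)) : ℝ :=
  ∑ S ∈ 𝓕, 1 / (n.choose S.card : ℝ)

/-- The `m` such that every `k`-coloring of `B_n` whose color classes all have size at least `m`
admits a strong rainbow copy of `A_k`. -/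
def sizeThresholds (n k : ℕ) : Set ℕ :=
  {m | ∀ φ : Coloring n k, (∀ i, m ≤ (colorClass φ.toPartial i).card) →
    HasStrongRainbowAntichain φ.toPartial}

/-- As `sizeThresholds`, for partial colorings. -/
def partialSizeThresholds (n k : ℕ) : Set ℕ :=
  {m | ∀ φ : PartialColoring n k, (∀ i, m ≤ (colorClass φ i).card) →
    HasStrongRainbowAntichain φ}

/-- The real `γ` such that every `k`-coloring of `B_n` whose color classes all have Lubell mass at
least `γ` admits a strong rainbow copy of `A_k`. -/
def massThresholds (n k : ℕ) : Set ℝ :=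
  {γ | ∀ φ : Coloring n k, (∀ i, γ ≤ lubellMass (colorClass φ.toPartial i)) →
    HasStrongRainbowAntichain φ.toPartial}

/-- As `massThresholds`, for partial colorings. -/
def partialMassThresholds (n k : ℕ) : Set ℝ :=
  {γ | ∀ φ : PartialColoring n k, (∀ i, γ ≤ lubellMass (colorClass φ i)) →
    HasStrongRainbowAntichain φ}

/-- `F(n,k)`: the smallest size threshold for `k`-colorings of `B_n`. -/
noncomputable def F (n k : ℕ) : ℕ := sInf (sizeThresholds n k)

/-- `F'(n,k)`: the smallest size threshold for partial `k`-colorings of `B_n`. -/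
noncomputable def FPartial (n k : ℕ) : ℕ := sInf (partialSizeThresholds n k)

/-- `G(n,k)`: the infimum of the Lubell mass thresholds for `k`-colorings of `B_n`. -/
noncomputable def G (n k : ℕ) : ℝ := sInf (massThresholds n k)

/-- `G'(n,k)`: the infimum of the Lubell mass thresholds for partial `k`-colorings of `B_n`. -/
noncomputable def GPartial (n k : ℕ) : ℝ := sInf (partialMassThresholds n k)

/-! The four infima are taken over nonempty sets that are bounded below, for `k ≥ 1` in the case
of sizes and for `k ≥ 2` in the case of Lubell masses, so none of them is a default value. -/

theorem partialSizeThresholds_nonempty (n k : ℕ) (hk : 1 ≤ k) :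
    (partialSizeThresholds n k).Nonempty := by
  refine ⟨2 ^ n + 1, fun φ h => absurd (h ⟨0, hk⟩) ?_⟩
  have := Finset.card_le_univ (colorClass φ ⟨0, hk⟩)
  simp at this
  omega

theorem sizeThresholds_nonempty (n k : ℕ) (hk : 1 ≤ k) : (sizeThresholds n k).Nonempty := by
  obtain ⟨m, h⟩ := partialSizeThresholds_nonempty n k hk
  exact ⟨m, fun φ hφ => h φ.toPartial hφ⟩

theorem partialMassThresholds_nonempty (n k : ℕ) (hk : 1 ≤ k) :
    (partialMassThresholds n k).Nonempty := by
  refine ⟨lubellMass (Finset.univ : Finset (B n)) + 1, fun φ h => absurd (h ⟨0, hk⟩) ?_⟩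
  have : lubellMass (colorClass φ ⟨0, hk⟩) ≤ lubellMass (Finset.univ : Finset (B n)) :=
    Finset.sum_le_sum_of_subset_of_nonneg (Finset.subset_univ _) (fun _ _ _ => by positivity)
  linarith

theorem massThresholds_nonempty (n k : ℕ) (hk : 1 ≤ k) : (massThresholds n k).Nonempty := by
  obtain ⟨γ, h⟩ := partialMassThresholds_nonempty n k hk
  exact ⟨γ, fun φ hφ => h φ.toPartial hφ⟩

theorem massThresholds_bddBelow (n k : ℕ) (hk : 2 ≤ k) : BddBelow (massThresholds n k) := by
  refine ⟨0, fun γ hγ => ?_⟩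
  by_contra hneg
  obtain ⟨X, ⟨α, -⟩, -, hX⟩ := hγ (fun _ => ⟨0, by omega⟩) fun i =>
    (not_le.mp hneg).le.trans (Finset.sum_nonneg fun _ _ => by positivity)
  have hne : α ⟨⟨0, by omega⟩⟩ ≠ α ⟨⟨1, by omega⟩⟩ := by
    simp [α.injective.eq_iff]
  exact hX _ (α _).2 _ (α _).2 (fun h => hne (Subtype.ext h)) rfl

theorem partialMassThresholds_bddBelow (n k : ℕ) (hk : 2 ≤ k) :
    BddBelow (partialMassThresholds n k) := by
  obtain ⟨b, hb⟩ := massThresholds_bddBelow n k hk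
  exact ⟨b, fun γ h => hb fun φ hφ => h φ.toPartial hφ⟩

end RainbowBoolean

namespace RainbowBoolean
open Finset

/-! A partial 2-coloring has no rainbow antichain exactly when every set of one color is comparable
with every set of the other (`CrossComparable`). Giving all uncolored sets a third color produces a
3-coloring without rainbow antichain (`exists_coloring`). So constructions for two colors carry over
to three, provided that the third class is large; for sizes this is ensured by trimming.

Conversely, take a 3-coloring without rainbow antichain, let `𝓒` be its largest class and `𝓐`, `𝓑`
the others. It is shown that `𝓐` and `𝓑` are cross-comparable, which makes them a partial 2-coloring
of the same quality. Suppose that `a ∈ 𝓐` and `b ∈ 𝓑` are incomparable. Every set incomparable with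
both lies in `𝓐 ∪ 𝓑`, and unless `a`, `b` are `{x}`, `{x}ᶜ` these sets fill a constant fraction of
the lattice (`Incomp.exists_interval`). Away from the extreme levels `𝓐` and `𝓑` are
cross-comparable, because an incomparable pair there would confine `𝓒` to a few small ideals and
filters. By `CrossComparable.exists_interval`, one of the two colors then avoids the inside of some
`[Y, Z]`, and the constant fraction forces `Y` and `Zᶜ` to be tiny. Hence that color almost
disappears from the middle. For sizes this is a contradiction; for masses,
`RainbowFree.lubellMass_le_of_not_isMiddle` bounds the mass of a color that lives on extreme levels.
If all incomparable pairs are of the form `{x}`, `{x}ᶜ`, then `exists_interval_of_specialPair` gives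
the structure of `𝓐` and `𝓑`, and they are too small.

The value `1 + √2` comes from the sets below and above one set of size `αn`. Their masses tend to `1
/ (1 - α)` and `1 / α`, and moving the full set from the upper to the lower family balances them at
`α = 1 - √2 / 2`. Optimality is `CrossComparable.lubellMass_false`, which rests on the real
inequality `two_add_two_sqrt_two_bound`. -/

/-! ### Lubell mass of ideals, filters, intervals and extreme levels -/

theorem lubellMass_mono {n : ℕ} {𝓕 𝓖 : Finset (B n)} (h : 𝓕 ⊆ 𝓖) :
    lubellMass 𝓕 ≤ lubellMass 𝓖 :=
  sum_le_sum_of_subset_of_nonneg h fun _ _ _ => by positivity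

theorem lubellMass_nonneg {n : ℕ} (𝓕 : Finset (B n)) : 0 ≤ lubellMass 𝓕 :=
  sum_nonneg fun _ _ => by positivity

theorem lubellMass_union {n : ℕ} {𝓕 𝓖 : Finset (B n)} (h : Disjoint 𝓕 𝓖) :
    lubellMass (𝓕 ∪ 𝓖) = lubellMass 𝓕 + lubellMass 𝓖 :=
  sum_union h

theorem lubellMass_union_le {n : ℕ} (𝓕 𝓖 : Finset (B n)) :
    lubellMass (𝓕 ∪ 𝓖) ≤ lubellMass 𝓕 + lubellMass 𝓖 := by
  have h := sum_union_inter (s₁ := 𝓕) (s₂ := 𝓖) (f := fun S => 1 / (n.choose S.card : ℝ))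
  have := lubellMass_nonneg (𝓕 ∩ 𝓖)
  unfold lubellMass at *
  linarith

theorem lubellMass_singleton {n : ℕ} (S : B n) :
    lubellMass {S} = 1 / (n.choose S.card : ℝ) := sum_singleton _ _

theorem lubellMass_insert_le {n : ℕ} (S : B n) (𝓕 : Finset (B n)) :
    lubellMass (insert S 𝓕) ≤ 1 / (n.choose S.card : ℝ) + lubellMass 𝓕 := by
  rw [insert_eq, ← lubellMass_singleton]
  exact lubellMass_union_le _ _

theorem lubellMass_le_card_div {n : ℕ} (𝓕 : Finset (B n))
    (h : ∀ S ∈ 𝓕, S.card = 1 ∨ S.card + 1 = n) : lubellMass 𝓕 ≤ 𝓕.card / n := by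
  have : ∀ S ∈ 𝓕, 1 / (n.choose S.card : ℝ) ≤ 1 / n := by
    intro S hS
    rcases h S hS with h | h
    · simp [h]
    · rw [← Nat.choose_symm (by omega), show n - S.card = 1 by omega]; simp
  calc lubellMass 𝓕 ≤ ∑ _S ∈ 𝓕, 1 / (n : ℝ) := sum_le_sum this
    _ = 𝓕.card / n := by simp [div_eq_mul_inv]

/-- The sets between `Y` and `Z` have Lubell mass `(n+1) B(|Y|+1, n-|Z|+1)`, with `B` the beta
function. -/
theorem lubellMass_Icc {n : ℕ} {Y Z : B n} (h : Y ⊆ Z) :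
    lubellMass (Icc Y Z) =
      (n + 1) * (Y.card.factorial * (Zᶜ).card.factorial) / (Y.card + (Zᶜ).card + 1).factorial := by
  obtain ⟨m, hm⟩ : ∃ m, (Z \ Y).card = m := ⟨_, rfl⟩
  induction m generalizing Y Z with
  | zero =>
    rw [card_eq_zero, sdiff_eq_empty_iff_subset] at hm
    obtain rfl := Subset.antisymm h hm
    have hc : Y.card + (Yᶜ).card = n := by simp
    have hle : Y.card ≤ n := by omega
    rw [Icc_self, lubellMass_singleton, hc, Nat.factorial_succ,
      ← Nat.choose_mul_factorial_mul_factorial hle, show n - Y.card = (Yᶜ).card by omega]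
    have := Nat.choose_pos hle
    push_cast
    field_simp
  | succ m ih =>
    obtain ⟨x, hx⟩ : (Z \ Y).Nonempty := by rw [← card_pos]; omega
    rw [mem_sdiff] at hx
    -- Splitting by whether `x ∈ S` mirrors the recurrence `B(p, q) = B(p + 1, q) + B(p, q + 1)`.
    have e : Icc Y Z = Icc (insert x Y) Z ∪ Icc Y (Z.erase x) := by
      ext S
      simp only [mem_union, mem_Icc, insert_subset_iff, subset_erase]
      by_cases hS : x ∈ S <;> simp [hS]
    have d : Disjoint (Icc (insert x Y) Z) (Icc Y (Z.erase x)) := by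
      rw [disjoint_left]
      intro S
      simp only [mem_Icc, insert_subset_iff, subset_erase]
      tauto
    have c1 : (Z \ insert x Y).card = m := by
      rw [sdiff_insert, card_erase_of_mem (by simp [hx])]; omega
    have c2 : (Z.erase x \ Y).card = m := by
      rw [erase_sdiff_comm, card_erase_of_mem (by simp [hx])]; omega
    have c3 : ((Z.erase x)ᶜ).card = (Zᶜ).card + 1 := by
      rw [compl_erase, card_insert_of_notMem (by simp [hx.1])]
    rw [e, lubellMass_union d, ih (insert_subset hx.1 h) c1,
      ih (subset_erase.2 ⟨h, hx.2⟩) c2, card_insert_of_notMem hx.2, c3,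
      show Y.card + 1 + (Zᶜ).card + 1 = Y.card + (Zᶜ).card + 1 + 1 by ring,
      show Y.card + ((Zᶜ).card + 1) + 1 = Y.card + (Zᶜ).card + 1 + 1 by ring,
      Nat.factorial_succ (Y.card + (Zᶜ).card + 1), Nat.factorial_succ Y.card,
      Nat.factorial_succ (Zᶜ).card]
    have := Nat.factorial_pos (Y.card + (Zᶜ).card + 1)
    push_cast
    field_simp
    ring

theorem card_compl_add {n : ℕ} (S : B n) : S.card + (Sᶜ).card = n := by
  simp

theorem lubellMass_univ (n : ℕ) : lubellMass (univ : Finset (B n)) = n + 1 := by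
  have h := lubellMass_Icc (empty_subset (univ : B n))
  have e : Icc (∅ : B n) univ = univ := by ext; simp
  rw [e] at h
  simpa using h

theorem lubellMass_Iic {n : ℕ} (Y : B n) :
    lubellMass (Iic Y) = (n + 1) / (n + 1 - Y.card : ℝ) := by
  have h := lubellMass_Icc (empty_subset Y)
  have e : Icc (∅ : B n) Y = Iic Y := by ext; simp
  have hc : (n : ℝ) = Y.card + (Yᶜ).card := by exact_mod_cast (card_compl_add Y).symm
  rw [e] at h
  rw [h, show (n + 1 - Y.card : ℝ) = (Yᶜ).card + 1 by linarith]
  have := Nat.factorial_pos (Yᶜ).card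
  simp only [card_empty, Nat.factorial_zero, Nat.cast_one, one_mul, zero_add, Nat.factorial_succ]
  push_cast
  field_simp

theorem lubellMass_Ici {n : ℕ} (Z : B n) :
    lubellMass (Ici Z) = (n + 1) / (n + 1 - (Zᶜ).card : ℝ) := by
  have h := lubellMass_Icc (subset_univ Z)
  have e : Icc Z (univ : B n) = Ici Z := by ext; simp
  have hc : (n : ℝ) = Z.card + (Zᶜ).card := by exact_mod_cast (card_compl_add Z).symm
  rw [e] at h
  rw [h, show (n + 1 - (Zᶜ).card : ℝ) = Z.card + 1 by linarith]
  have := Nat.factorial_pos Z.card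
  simp only [compl_univ, card_empty, Nat.factorial_zero, Nat.cast_one, mul_one, add_zero,
    Nat.factorial_succ]
  push_cast
  field_simp

theorem lubellMass_Icc_le {n : ℕ} (Y Z : B n) :
    lubellMass (Icc Y Z) ≤ (n + 1) / (Y.card + (Zᶜ).card + 1 : ℝ) := by
  by_cases h : Y ⊆ Z
  · have h2 := Nat.le_of_dvd (Nat.factorial_pos _)
      (Nat.factorial_mul_factorial_dvd_factorial_add Y.card (Zᶜ).card)
    have h3 := Nat.factorial_pos (Y.card + (Zᶜ).card)
    rw [lubellMass_Icc h, Nat.factorial_succ, mul_div_assoc]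
    rw [div_eq_mul_one_div (n + 1 : ℝ) (Y.card + (Zᶜ).card + 1 : ℝ)]
    refine mul_le_mul_of_nonneg_left ?_ (by positivity)
    rw [div_le_div_iff₀ (by positivity) (by positivity)]
    have : (Y.card.factorial * (Zᶜ).card.factorial : ℝ) ≤ (Y.card + (Zᶜ).card).factorial := by
      exact_mod_cast h2
    push_cast
    nlinarith
  · rw [Icc_eq_empty h]
    have : lubellMass (∅ : Finset (B n)) = 0 := sum_empty
    rw [this]; positivity

theorem factorial_mul_factorial_mul_add_le (y c : ℕ) (hy : 1 ≤ y) (hc : 1 ≤ c) :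
    y.factorial * c.factorial * (y + c) ≤ (y + c).factorial := by
  obtain ⟨c, rfl⟩ := Nat.exists_eq_add_of_le' hc
  have key : y.factorial * (c + 1).factorial ≤ (y + c).factorial := by
    induction y, hy using Nat.le_induction with
    | base => simp [add_comm]
    | succ y _ ih =>
      rw [Nat.factorial_succ, show y + 1 + c = y + c + 1 by ring, Nat.factorial_succ, mul_assoc]
      exact Nat.mul_le_mul (by omega) ih
  rw [show y + (c + 1) = y + c + 1 by ring, Nat.factorial_succ, mul_comm]
  exact Nat.mul_le_mul_left _ key

/-- When both ends are proper, `binom(y + c, y) ≥ y + c` saves a further factor `y + c` over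
`lubellMass_Icc_le`. -/
theorem lubellMass_Icc_mul_le {n : ℕ} (Y Z : B n) (hY : 1 ≤ Y.card) (hZ : 1 ≤ (Zᶜ).card) :
    lubellMass (Icc Y Z) * ((Y.card + (Zᶜ).card) * (Y.card + (Zᶜ).card + 1) : ℝ) ≤ n + 1 := by
  by_cases h : Y ⊆ Z
  · have h2 := factorial_mul_factorial_mul_add_le Y.card (Zᶜ).card hY hZ
    have h3 := Nat.factorial_pos (Y.card + (Zᶜ).card)
    rw [lubellMass_Icc h, Nat.factorial_succ]
    have : (Y.card.factorial * (Zᶜ).card.factorial * (Y.card + (Zᶜ).card) : ℝ)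
        ≤ (Y.card + (Zᶜ).card).factorial := by
      exact_mod_cast h2
    rw [div_mul_eq_mul_div, div_le_iff₀ (by positivity)]
    push_cast
    calc _ = ((n : ℝ) + 1) * (Y.card + (Zᶜ).card + 1) *
          (Y.card.factorial * (Zᶜ).card.factorial * (Y.card + (Zᶜ).card)) := by ring
      _ ≤ ((n : ℝ) + 1) * (Y.card + (Zᶜ).card + 1) * (Y.card + (Zᶜ).card).factorial := by gcongr
      _ = _ := by ring
  · rw [Icc_eq_empty h]
    have : lubellMass (∅ : Finset (B n)) = 0 := sum_empty
    rw [this]; simp; positivity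

/-- The worst case is `|P| = |Qᶜ| = 2`, where `5! / (2! 2!) = 30`. -/
theorem le_lubellMass_Icc {n : ℕ} {P Q : B n} (h : P ⊆ Q) (hP : P.card ≤ 2)
    (hQ : (Qᶜ).card ≤ 2) : (n + 1) / 30 ≤ lubellMass (Icc P Q) := by
  rw [lubellMass_Icc h]
  have hn : (0 : ℝ) ≤ n := by positivity
  generalize P.card = p at *
  generalize (Qᶜ).card = q at *
  interval_cases p <;> interval_cases q <;> norm_num [Nat.factorial] <;> linarith

theorem lubellMass_card_lt {n : ℕ} (t : ℕ) :
    lubellMass (univ.filter fun S : B n => S.card < t) ≤ t := by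
  induction t with
  | zero => simp [lubellMass]
  | succ t ih =>
    have hsub : (univ.filter fun S : B n => S.card < t + 1) ⊆
        (univ.filter fun S : B n => S.card < t) ∪ powersetCard t univ := by
      intro S; simp [mem_powersetCard]; omega
    have hl : lubellMass (powersetCard t (univ : B n)) ≤ 1 := by
      have : lubellMass (powersetCard t (univ : B n)) =
          ∑ S ∈ powersetCard t (univ : B n), 1 / (n.choose t : ℝ) :=
        sum_congr rfl fun S hS => by rw [(mem_powersetCard.1 hS).2]
      rw [this]
      simp only [sum_const, card_powersetCard, card_univ, Fintype.card_fin, nsmul_eq_mul]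
      rw [mul_one_div]
      exact div_self_le_one _
    have := (lubellMass_mono hsub).trans (lubellMass_union_le _ _)
    push_cast
    linarith

theorem lubellMass_image_compl {n : ℕ} (𝓕 : Finset (B n)) :
    lubellMass (𝓕.image compl) = lubellMass 𝓕 := by
  unfold lubellMass
  rw [sum_image (fun a _ b _ h => compl_injective h)]
  refine sum_congr rfl fun S _ => ?_
  have := card_compl_add S
  rw [← Nat.choose_symm (show S.card ≤ n by omega), show n - S.card = (Sᶜ).card by omega]

theorem lubellMass_lt_card {n : ℕ} (t : ℕ) :
    lubellMass (univ.filter fun S : B n => n < S.card + t) ≤ t := by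
  rw [← lubellMass_image_compl]
  refine le_trans (lubellMass_mono ?_) (lubellMass_card_lt t)
  intro S hS
  obtain ⟨T, hT, rfl⟩ := mem_image.1 hS
  have := card_compl_add T
  simp at hT ⊢
  rw [card_compl, Fintype.card_fin] at *
  omega

/-! ### Cross-comparable pairs and their cuts -/

/-- Neither of the two sets contains the other. -/
def Incomp {n : ℕ} (S T : B n) : Prop := ¬ S ⊆ T ∧ ¬ T ⊆ S

theorem Incomp.symm {n : ℕ} {S T : B n} (h : Incomp S T) : Incomp T S := ⟨h.2, h.1⟩

/-- Every member of `𝓐` is comparable with every member of `𝓑`. -/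
def CrossComparable {n : ℕ} (𝓐 𝓑 : Finset (B n)) : Prop :=
  ∀ S ∈ 𝓐, ∀ T ∈ 𝓑, S ⊆ T ∨ T ⊆ S

theorem CrossComparable.symm {n : ℕ} {𝓐 𝓑 : Finset (B n)} (h : CrossComparable 𝓐 𝓑) :
    CrossComparable 𝓑 𝓐 := fun S hS T hT => (h T hT S hS).symm

theorem CrossComparable.mono {n : ℕ} {𝓐 𝓑 𝓐' 𝓑' : Finset (B n)} (h : CrossComparable 𝓐 𝓑)
    (hA : 𝓐' ⊆ 𝓐) (hB : 𝓑' ⊆ 𝓑) : CrossComparable 𝓐' 𝓑' :=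
  fun S hS T hT => h S (hA hS) T (hB hT)

/-- The cut is the union of `𝓑`. A member of `𝓐` either lies below some member of `𝓑`, hence below
the union, or contains every member of `𝓑`. The largest set `S`, being in `𝓐`, contains all of `𝓑`
and keeps the union strictly below `Z`. -/
theorem CrossComparable.exists_cut_of_le {n : ℕ} {𝓐 𝓑 : Finset (B n)}
    (h : CrossComparable 𝓐 𝓑) {Y Z S : B n} (hS : S ∈ 𝓐) (hmax : ∀ T ∈ 𝓑, T.card ≤ S.card)
    (hSZ : S ⊂ Z) (hne : 𝓑.Nonempty) (hY : ∀ T ∈ 𝓑, Y ⊂ T) :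
    ∃ U, Y ⊂ U ∧ U ⊂ Z ∧ ∀ T ∈ 𝓐 ∪ 𝓑, T ⊆ U ∨ U ⊆ T := by
  have hsub : ∀ T ∈ 𝓑, T ⊆ S := by
    intro T hT
    rcases h S hS T hT with h1 | h1
    · exact (eq_of_subset_of_card_le h1 (hmax T hT)).ge
    · exact h1
  refine ⟨𝓑.sup id, ?_, lt_of_le_of_lt (Finset.sup_le hsub) hSZ, ?_⟩
  · obtain ⟨T, hT⟩ := hne
    exact lt_of_lt_of_le (hY T hT) (le_sup (f := id) hT)
  · intro T hT
    rcases mem_union.1 hT with hT | hT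
    · by_cases hex : ∃ b ∈ 𝓑, T ⊆ b
      · obtain ⟨b, hb, hTb⟩ := hex
        exact Or.inl (hTb.trans (le_sup (f := id) hb))
      · push Not at hex
        exact Or.inr (Finset.sup_le fun b hb => (h T hT b hb).resolve_left (hex b hb))
    · exact Or.inl (le_sup (f := id) hT)

theorem CrossComparable.exists_cut {n : ℕ} {𝓐 𝓑 : Finset (B n)}
    (h : CrossComparable 𝓐 𝓑) {Y Z : B n} (hneA : 𝓐.Nonempty) (hneB : 𝓑.Nonempty)
    (hA : ∀ T ∈ 𝓐, Y ⊂ T ∧ T ⊂ Z) (hB : ∀ T ∈ 𝓑, Y ⊂ T ∧ T ⊂ Z) :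
    ∃ U, Y ⊂ U ∧ U ⊂ Z ∧ ∀ T ∈ 𝓐 ∪ 𝓑, T ⊆ U ∨ U ⊆ T := by
  obtain ⟨S, hS, hmax⟩ := exists_max_image (𝓐 ∪ 𝓑) card (hneA.mono subset_union_left)
  rcases mem_union.1 hS with hS | hS
  · exact h.exists_cut_of_le hS (fun T hT => hmax T (mem_union_right _ hT)) (hA S hS).2 hneB
      fun T hT => (hB T hT).1
  · rw [union_comm]
    exact h.symm.exists_cut_of_le hS (fun T hT => hmax T (mem_union_left _ hT)) (hB S hS).2 hneA
      fun T hT => (hA T hT).1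

/-- Around the middle level, a cross-comparable pair has only one of its two colors. -/
theorem CrossComparable.exists_interval {n : ℕ} {𝓐 𝓑 : Finset (B n)}
    (h : CrossComparable 𝓐 𝓑) :
    ∃ Y Z : B n, Y ⊆ Z ∧ 2 * Y.card ≤ n ∧ 2 * (Zᶜ).card ≤ n ∧
      (∀ T ∈ 𝓐 ∪ 𝓑, T ⊆ Y ∨ Z ⊆ T ∨ Y ⊂ T ∧ T ⊂ Z) ∧
      ((∀ T ∈ 𝓐, T ⊆ Y ∨ Z ⊆ T) ∨ (∀ T ∈ 𝓑, T ⊆ Y ∨ Z ⊆ T)) := by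
  classical
  let cut : B n → Prop := fun U => ∀ T ∈ 𝓐 ∪ 𝓑, T ⊆ U ∨ U ⊆ T
  -- `Y` is a largest cut in the lower half, and `Z` a smallest cut in the upper half above `Y`. If
  -- both colors occurred strictly between them, `exists_cut` would give a cut strictly between,
  -- against one of the two choices.
  obtain ⟨Y, hY, hYmax⟩ := exists_max_image (univ.filter fun U => cut U ∧ 2 * U.card ≤ n) card
    ⟨∅, by simp [cut]⟩
  simp only [mem_filter, mem_univ, true_and] at hY hYmax
  obtain ⟨Z, hZ, hZmin⟩ := exists_min_image
    (univ.filter fun U => cut U ∧ n ≤ 2 * U.card ∧ Y ⊆ U) card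
    ⟨univ, by simp [cut]; omega⟩
  simp only [mem_filter, mem_univ, true_and] at hZ hZmin
  have hcut : ∀ T ∈ 𝓐 ∪ 𝓑, T ⊆ Y ∨ Z ⊆ T ∨ Y ⊂ T ∧ T ⊂ Z := by
    intro T hT
    by_cases h1 : T ⊆ Y
    · exact Or.inl h1
    by_cases h2 : Z ⊆ T
    · exact Or.inr (Or.inl h2)
    exact Or.inr (Or.inr ⟨⟨(hY.1 T hT).resolve_left h1, h1⟩, ⟨(hZ.1 T hT).resolve_right h2, h2⟩⟩)
  refine ⟨Y, Z, hZ.2.2, hY.2, ?_, hcut, ?_⟩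
  · have := card_compl_add Z; omega
  by_contra hcon
  push Not at hcon
  obtain ⟨⟨a, ha, ha1, ha2⟩, b, hb, hb1, hb2⟩ := hcon
  have hain := ((hcut a (mem_union_left _ ha)).resolve_left ha1).resolve_left ha2
  have hbin := ((hcut b (mem_union_right _ hb)).resolve_left hb1).resolve_left hb2
  obtain ⟨U, hYU, hUZ, hU⟩ := (h.mono (filter_subset (fun T => Y ⊂ T ∧ T ⊂ Z) _)
      (filter_subset (fun T => Y ⊂ T ∧ T ⊂ Z) _)).exists_cut (Y := Y) (Z := Z)
      ⟨a, mem_filter.2 ⟨ha, hain⟩⟩ ⟨b, mem_filter.2 ⟨hb, hbin⟩⟩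
      (fun T hT => (mem_filter.1 hT).2) (fun T hT => (mem_filter.1 hT).2)
  have hUcut : cut U := by
    intro T hT
    rcases hcut T hT with h1 | h1 | h1
    · exact Or.inl (h1.trans hYU.subset)
    · exact Or.inr (hUZ.subset.trans h1)
    · exact hU T (by rw [← filter_union]; exact mem_filter.2 ⟨hT, h1⟩)
  have c1 := card_lt_card hYU
  have c2 := card_lt_card hUZ
  by_cases hc : 2 * U.card ≤ n
  · have := hYmax U ⟨hUcut, hc⟩; omega
  · have := hZmin U ⟨hUcut, by omega, hYU.subset⟩; omega

/-! ### Incomparable pairs, special and not -/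

/-- A singleton and the complement of the same singleton, in either order. -/
def SpecialPair {n : ℕ} (S T : B n) : Prop := ∃ x : Fin n, S = {x} ∧ T = {x}ᶜ ∨ S = {x}ᶜ ∧ T = {x}

theorem SpecialPair.symm {n : ℕ} {S T : B n} (h : SpecialPair S T) : SpecialPair T S := by
  obtain ⟨x, h | h⟩ := h
  · exact ⟨x, Or.inr ⟨h.2, h.1⟩⟩
  · exact ⟨x, Or.inl ⟨h.2, h.1⟩⟩

/-- Incomparable sets that are not a special pair have a large interval of sets that are
incomparable with both. -/
theorem Incomp.exists_interval {n : ℕ} {a b : B n} (h : Incomp a b) (hs : ¬ SpecialPair a b) :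
    ∃ P Q : B n, P ⊆ Q ∧ P.card ≤ 2 ∧ (Qᶜ).card ≤ 2 ∧
      ∀ S ∈ Icc P Q, Incomp S a ∧ Incomp S b := by
  suffices ∃ P R : B n, Disjoint P R ∧ P.card ≤ 2 ∧ R.card ≤ 2 ∧
      ∀ S, P ⊆ S → Disjoint S R → Incomp S a ∧ Incomp S b by
    obtain ⟨P, R, hd, hP, hR, hS⟩ := this
    refine ⟨P, Rᶜ, subset_compl_iff_disjoint_right.2 hd, hP, by simpa using hR, fun S hmem => ?_⟩
    rw [mem_Icc] at hmem
    exact hS S hmem.1 (subset_compl_iff_disjoint_right.1 hmem.2)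
  obtain ⟨x, hxa, hxb⟩ := not_subset.1 h.1
  obtain ⟨y, hyb, hya⟩ := not_subset.1 h.2
  have hxy : x ≠ y := fun e => hya (e ▸ hxa)
  unfold Incomp
  simp only [not_subset]
  -- With a common non-element `z`, sets containing `z` and missing `x`, `y` are incomparable with
  -- both. With a common element the dual choice works. Otherwise `b = aᶜ`, and not being special
  -- provides second elements `x' ∈ a` and `y' ∈ b` to be left out.
  by_cases h1 : ∃ z, z ∉ a ∧ z ∉ b
  · obtain ⟨z, hza, hzb⟩ := h1
    have hzx : z ≠ x := fun e => hza (e ▸ hxa)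
    have hzy : z ≠ y := fun e => hzb (e ▸ hyb)
    refine ⟨{z}, {x, y}, by simp [hzx, hzy], by simp, card_le_two, fun S hP hR => ?_⟩
    simp only [disjoint_insert_right, disjoint_singleton_right, singleton_subset_iff] at hP hR
    exact ⟨⟨⟨z, hP, hza⟩, x, hxa, hR.1⟩, ⟨z, hP, hzb⟩, y, hyb, hR.2⟩
  by_cases h2 : ∃ z, z ∈ a ∧ z ∈ b
  · obtain ⟨z, hza, hzb⟩ := h2
    have hzx : x ≠ z := fun e => hxb (e ▸ hzb)
    have hzy : y ≠ z := fun e => hya (e ▸ hza)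
    refine ⟨{x, y}, {z}, by simp [hzx.symm, hzy.symm], card_le_two, by simp, fun S hP hR => ?_⟩
    simp only [disjoint_singleton_right, insert_subset_iff, singleton_subset_iff] at hP hR
    exact ⟨⟨⟨y, hP.2, hya⟩, z, hza, hR⟩, ⟨x, hP.1, hxb⟩, z, hzb, hR⟩
  push Not at h1 h2
  have hb : b = aᶜ := by
    ext z; rw [mem_compl]; exact ⟨fun hz hz' => h2 z hz' hz, h1 z⟩
  have hx' : ∃ x' ∈ a, x' ≠ x := by
    by_contra hcon
    push Not at hcon
    have : a = {x} := eq_singleton_iff_unique_mem.2 ⟨hxa, hcon⟩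
    exact hs ⟨x, Or.inl ⟨this, this ▸ hb⟩⟩
  have hy' : ∃ y' ∈ b, y' ≠ y := by
    by_contra hcon
    push Not at hcon
    have : b = {y} := eq_singleton_iff_unique_mem.2 ⟨hyb, hcon⟩
    exact hs ⟨y, Or.inr ⟨by rw [← this, hb, compl_compl], this⟩⟩
  obtain ⟨x', hxa', hxx⟩ := hx'
  obtain ⟨y', hyb', hyy⟩ := hy'
  refine ⟨{x, y}, {x', y'}, ?_, card_le_two, card_le_two, fun S hP hR => ?_⟩
  · have e1 : x ≠ y' := fun e => h2 x hxa (e ▸ hyb')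
    have e2 : y ≠ x' := fun e => h2 y (e ▸ hxa') hyb
    simp [hxx, hyy, e1.symm, e2.symm]
  · simp only [disjoint_insert_right, disjoint_singleton_right, insert_subset_iff,
      singleton_subset_iff] at hP hR
    exact ⟨⟨⟨y, hP.2, hya⟩, x', hxa', hR.1⟩, ⟨x, hP.1, hxb⟩, y', hyb', hR.2⟩

/-- If the only incomparable pairs are special, and there is one, then up to singletons, their
complements, `∅` and the whole set, all of `𝓐` lies below all of `𝓑`. -/
theorem exists_interval_of_specialPair {n : ℕ} (hn : 3 ≤ n) {𝓐 𝓑 : Finset (B n)}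
    (hd : Disjoint 𝓐 𝓑) (hs : ∀ a ∈ 𝓐, ∀ b ∈ 𝓑, Incomp a b → SpecialPair a b)
    {x : Fin n} (hx : {x} ∈ 𝓐) (hx' : {x}ᶜ ∈ 𝓑) :
    ∃ Y Z : B n, Y ⊂ Z ∧ 𝓐 ⊆ insert univ (Iic Y ∪ (Z \ Y).image fun p => {p}) ∧
      𝓑 ⊆ insert ∅ (Ici Z ∪ (Z \ Y).image fun p => {p}ᶜ) := by
  rw [disjoint_left] at hd
  have c1 : ∀ z : Fin n, ({z} : B n).card = 1 := fun z => card_singleton z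
  have cn : ∀ z : Fin n, (({z} : B n)ᶜ).card = n - 1 := fun z => by simp [card_compl]
  have comp : ∀ a ∈ 𝓐, ∀ b ∈ 𝓑, (a.card ≠ 1 ∨ b.card ≠ n - 1) → (a.card ≠ n - 1 ∨ b.card ≠ 1) →
      a ⊆ b ∨ b ⊆ a := by
    intro a ha b hb h1 h2
    by_contra hcon
    push Not at hcon
    obtain ⟨z, ⟨rfl, rfl⟩ | ⟨rfl, rfl⟩⟩ := hs a ha b hb hcon
    · simp [c1, cn] at h1
    · simp [c1, cn] at h2
  -- Comparability with `{x}ᶜ` means that an `a` containing `x` contains `{x}ᶜ` too, so it is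
  -- everything. Dually, comparability with `{x}` puts `x` into the members of `𝓑`. Then `x`
  -- separates the two families and orients every comparison.
  have hA : ∀ a ∈ 𝓐, a ≠ univ → a.card ≠ 1 → x ∉ a := by
    intro a ha hu h1 hxa
    rcases comp a ha _ hx' (Or.inl h1) (Or.inr (by rw [cn]; omega)) with h | h
    · simpa using h hxa
    · apply hu
      rw [eq_univ_iff_forall]
      intro z
      by_cases hz : z = x
      · exact hz ▸ hxa
      · exact h (by simp [hz])
  have hB : ∀ b ∈ 𝓑, b ≠ ∅ → b.card ≠ n - 1 → x ∈ b := by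
    intro b hb he h1
    by_contra hxb
    rcases comp _ hx b hb (Or.inr h1) (Or.inl (by rw [c1]; omega)) with h | h
    · exact hxb (by simpa using h)
    · rcases subset_singleton_iff.1 h with h | h
      · exact he h
      · exact hxb (by simp [h])
  have hAB : ∀ a ∈ 𝓐, a ≠ univ → a.card ≠ 1 → ∀ b ∈ 𝓑, b ≠ ∅ → b.card ≠ n - 1 → a ⊆ b := by
    intro a ha hu h1 b hb he h2
    have hxa := hA a ha hu h1
    have hxb := hB b hb he h2
    by_cases hb1 : b.card = 1
    · obtain ⟨z, rfl⟩ := card_eq_one.1 hb1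
      simp only [mem_singleton] at hxb
      exact absurd hb (hxb ▸ hd hx)
    rcases comp a ha b hb (Or.inl h1) (Or.inr hb1) with h | h
    · exact h
    · exact absurd (h hxb) hxa
  -- The element `x` lies in `Z` and not in `Y`, which makes the inclusion strict.
  let Y := (𝓐.filter fun a => a ≠ univ ∧ a.card ≠ 1).sup id
  let Z := (𝓑.filter fun b => b ≠ ∅ ∧ b.card ≠ n - 1).inf id
  have memY : ∀ z, z ∈ Y ↔ ∃ a ∈ 𝓐, a ≠ univ ∧ a.card ≠ 1 ∧ z ∈ a := by
    intro z; simp [Y, mem_sup, and_assoc]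
  have memZ : ∀ z, z ∈ Z ↔ ∀ b ∈ 𝓑, b ≠ ∅ → b.card ≠ n - 1 → z ∈ b := by
    intro z; simp [Z, mem_inf, and_imp]
  refine ⟨Y, Z, ⟨fun z hz => ?_, fun h => ?_⟩, fun a ha => ?_, fun b hb => ?_⟩
  · obtain ⟨a, ha, hu, h1, hz⟩ := (memY z).1 hz
    exact (memZ z).2 fun b hb he h2 => hAB a ha hu h1 b hb he h2 hz
  · obtain ⟨a, ha, hu, h1, hz⟩ := (memY x).1 (h ((memZ x).2 hB))
    exact hA a ha hu h1 hz
  · by_cases hu : a = univ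
    · simp [hu]
    refine mem_insert_of_mem (mem_union.2 ?_)
    by_cases h1 : a.card = 1
    · obtain ⟨p, rfl⟩ := card_eq_one.1 h1
      by_cases hp : p ∈ Y
      · left; simpa using hp
      · right
        refine mem_image.2 ⟨p, mem_sdiff.2 ⟨(memZ p).2 fun b hb he h2 => ?_, hp⟩, rfl⟩
        rcases comp _ ha b hb (Or.inr h2) (Or.inl (by rw [c1]; omega)) with h | h
        · simpa using h
        · rcases subset_singleton_iff.1 h with h | h
          · exact absurd h he
          · simp [h]
    · left
      exact mem_Iic.2 fun z hz => (memY z).2 ⟨a, ha, hu, h1, hz⟩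
  · by_cases he : b = ∅
    · simp [he]
    refine mem_insert_of_mem (mem_union.2 ?_)
    by_cases h1 : b.card = n - 1
    · obtain ⟨p, hp⟩ : ∃ p, bᶜ = {p} := card_eq_one.1 (by rw [card_compl, h1]; simp; omega)
      obtain rfl : b = {p}ᶜ := by rw [← hp, compl_compl]
      by_cases hpZ : p ∈ Z
      · right
        refine mem_image.2 ⟨p, mem_sdiff.2 ⟨hpZ, fun hpY => ?_⟩, rfl⟩
        obtain ⟨a, ha, hu, h1, hz⟩ := (memY p).1 hpY
        rcases comp a ha _ hb (Or.inl h1) (Or.inr (by rw [cn]; omega)) with h | h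
        · simpa using h hz
        · apply hu
          rw [eq_univ_iff_forall]
          intro z
          by_cases hzp : z = p
          · exact hzp ▸ hz
          · exact h (by simp [hzp])
      · left
        simp only [mem_Ici]
        intro z hz
        simp only [mem_compl, mem_singleton]
        rintro rfl
        exact hpZ hz
    · left
      exact mem_Ici.2 fun z hz => (memZ z).1 hz b hb he h1

/-! ### From colorings to families of sets -/

/-- A rainbow copy has `k` members and `k` available colors, so each color occurs exactly once and
the members can be indexed by color. -/
theorem hasStrongRainbowAntichain_iff {n k : ℕ} (φ : PartialColoring n k) :
    HasStrongRainbowAntichain φ ↔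
      ∃ f : Fin k → B n, (∀ i, φ (f i) = some i) ∧ ∀ i j, i ≠ j → Incomp (f i) (f j) := by
  constructor
  · rintro ⟨X, ⟨α, hα⟩, hcol, hdist⟩
    have h1 : ∀ i : Fin k, ∃ c, φ (α ⟨i⟩) = some c := fun i =>
      Option.ne_none_iff_exists'.1 (hcol _ (α ⟨i⟩).2)
    choose c hc using h1
    have hinj : Function.Injective c := by
      intro i j hij
      by_contra hne
      refine hdist _ (α ⟨i⟩).2 _ (α ⟨j⟩).2 (fun h => hne ?_) (by rw [hc, hc, hij])
      have := α.injective (Subtype.ext h)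
      simpa using this
    let e := Equiv.ofBijective c (Finite.injective_iff_bijective.1 hinj)
    refine ⟨fun i => α ⟨e.symm i⟩, fun i => ?_, fun i j hij => ?_⟩
    · rw [hc]; exact congrArg some (e.apply_symm_apply i)
    · have key : ∀ i j, i ≠ j → ¬ (α ⟨e.symm i⟩ : B n) ⊆ α ⟨e.symm j⟩ := by
        intro i j hij h
        have : (⟨e.symm i⟩ : A k) = ⟨e.symm j⟩ := (hα _ _).2 h
        exact hij (e.symm.injective (by simpa using this))
      exact ⟨key i j hij, key j i hij.symm⟩
  · rintro ⟨f, hf, hinc⟩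
    have hinj : Function.Injective f := fun i j h => by
      have := hf i; rw [h, hf j] at this; simpa using this.symm
    let e : A k ≃ Set.range f :=
      (⟨A.val, A.mk, fun _ => rfl, fun _ => rfl⟩ : A k ≃ Fin k).trans (Equiv.ofInjective f hinj)
    refine ⟨Set.range f, ⟨e, fun p q => ⟨fun h => ?_, fun h => ?_⟩⟩, ?_, ?_⟩
    · have : p = q := h
      rw [this]
    · by_contra hpq
      have hne : p.val ≠ q.val := fun h => hpq (by cases p; cases q; exact congrArg A.mk h)
      exact (hinc _ _ hne).1 h
    · rintro _ ⟨i, rfl⟩; simp [hf]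
    · rintro _ ⟨i, rfl⟩ _ ⟨j, rfl⟩ hne
      rw [hf, hf]
      exact fun h => hne (by simp at h; rw [h])

/-- A partition of the Boolean lattice into three parts without a rainbow antichain. -/
structure RainbowFree {n : ℕ} (𝓐 𝓑 𝓒 : Finset (B n)) : Prop where
  cover : ∀ S, S ∈ 𝓐 ∨ S ∈ 𝓑 ∨ S ∈ 𝓒
  disjoint_left : Disjoint 𝓐 𝓑
  disjoint_outer : Disjoint 𝓐 𝓒
  disjoint_right : Disjoint 𝓑 𝓒
  free : ∀ a ∈ 𝓐, ∀ b ∈ 𝓑, ∀ c ∈ 𝓒, Incomp a b → Incomp a c → Incomp b c → False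

theorem RainbowFree.swap {n : ℕ} {𝓐 𝓑 𝓒 : Finset (B n)} (h : RainbowFree 𝓐 𝓑 𝓒) :
    RainbowFree 𝓑 𝓐 𝓒 where
  cover S := by have := h.cover S; tauto
  disjoint_left := h.disjoint_left.symm
  disjoint_outer := h.disjoint_right
  disjoint_right := h.disjoint_outer
  free b hb a ha c hc h1 h2 h3 := h.free a ha b hb c hc h1.symm h3 h2

theorem mem_colorClass {n k : ℕ} {φ : PartialColoring n k} {i : Fin k} {S : B n} :
    S ∈ colorClass φ i ↔ φ S = some i := by simp [colorClass]

theorem disjoint_colorClass {n k : ℕ} (φ : PartialColoring n k) {i j : Fin k} (h : i ≠ j) :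
    Disjoint (colorClass φ i) (colorClass φ j) := by
  rw [Finset.disjoint_left]
  intro S h1 h2
  rw [mem_colorClass] at h1 h2
  exact h (by simpa using h1.symm.trans h2)

theorem crossComparable_colorClass {n : ℕ} {φ : PartialColoring n 2}
    (h : ¬ HasStrongRainbowAntichain φ) : CrossComparable (colorClass φ 0) (colorClass φ 1) := by
  intro S hS T hT
  by_contra hcon
  push Not at hcon
  rw [mem_colorClass] at hS hT
  refine h ((hasStrongRainbowAntichain_iff φ).2 ⟨![S, T], ?_, ?_⟩)
  · intro i; fin_cases i <;> simp [hS, hT]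
  · intro i j hij
    fin_cases i <;> fin_cases j <;> simp_all [Incomp]

theorem rainbowFree_colorClass {n : ℕ} {φ : Coloring n 3}
    (h : ¬ HasStrongRainbowAntichain φ.toPartial) {i j l : Fin 3} (hij : i ≠ j) (hil : i ≠ l)
    (hjl : j ≠ l) : RainbowFree (colorClass φ.toPartial i) (colorClass φ.toPartial j)
      (colorClass φ.toPartial l) where
  cover S := by
    simp only [mem_colorClass, Coloring.toPartial, Option.some_inj]
    omega
  disjoint_left := disjoint_colorClass _ hij
  disjoint_outer := disjoint_colorClass _ hil
  disjoint_right := disjoint_colorClass _ hjl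
  free a ha b hb c hc hab hac hbc := by
    rw [mem_colorClass] at ha hb hc
    have hl : ∀ t : Fin 3, t ≠ i → t ≠ j → t = l := by omega
    refine h ((hasStrongRainbowAntichain_iff _).2
      ⟨fun t => if t = i then a else if t = j then b else c, fun t => ?_, fun s t hst => ?_⟩)
    · by_cases h1 : t = i
      · simp [h1, ha]
      by_cases h2 : t = j
      · simp [h2, hij.symm, hb]
      · simp [hl t h1 h2, hil.symm, hjl.symm, hc]
    · have := hab.symm
      have := hac.symm
      have := hbc.symm
      by_cases h1 : s = i <;> by_cases h2 : t = i <;> by_cases h3 : s = j <;>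
        by_cases h4 : t = j <;>
        first
        | exact (hst ((hl s h1 h3).trans (hl t h2 h4).symm)).elim
        | simp_all

theorem exists_partialColoring {n : ℕ} {𝓐 𝓑 : Finset (B n)} (hd : Disjoint 𝓐 𝓑)
    (h : CrossComparable 𝓐 𝓑) : ∃ φ : PartialColoring n 2, colorClass φ 0 = 𝓐 ∧
      colorClass φ 1 = 𝓑 ∧ ¬ HasStrongRainbowAntichain φ := by
  rw [Finset.disjoint_left] at hd
  let φ : PartialColoring n 2 := fun S =>
    if S ∈ 𝓐 then some 0 else if S ∈ 𝓑 then some 1 else none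
  have h0 : colorClass φ 0 = 𝓐 := by
    ext S
    simp only [mem_colorClass, φ]
    split_ifs <;> simp_all
  have h1 : colorClass φ 1 = 𝓑 := by
    ext S
    simp only [mem_colorClass, φ]
    split_ifs with h1 <;> simp_all
  refine ⟨φ, h0, h1, fun hs => ?_⟩
  obtain ⟨f, hf, hinc⟩ := (hasStrongRainbowAntichain_iff _).1 hs
  have ha := mem_colorClass.2 (hf 0)
  have hb := mem_colorClass.2 (hf 1)
  rw [h0] at ha
  rw [h1] at hb
  have := hinc 0 1 (by simp)
  have := h _ ha _ hb
  unfold Incomp at *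
  tauto

/-- A rainbow antichain on three colors would contain an incomparable pair from `𝓐` and `𝓑`. -/
theorem exists_coloring {n : ℕ} {𝓐 𝓑 : Finset (B n)} (hd : Disjoint 𝓐 𝓑)
    (h : CrossComparable 𝓐 𝓑) : ∃ φ : Coloring n 3, colorClass φ.toPartial 0 = 𝓐 ∧
      colorClass φ.toPartial 1 = 𝓑 ∧ colorClass φ.toPartial 2 = (𝓐 ∪ 𝓑)ᶜ ∧
      ¬ HasStrongRainbowAntichain φ.toPartial := by
  rw [Finset.disjoint_left] at hd
  let φ : Coloring n 3 := fun S => if S ∈ 𝓐 then 0 else if S ∈ 𝓑 then 1 else 2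
  have h0 : colorClass φ.toPartial 0 = 𝓐 := by
    ext S
    simp only [mem_colorClass, Coloring.toPartial, φ]
    split_ifs <;> simp_all
  have h1 : colorClass φ.toPartial 1 = 𝓑 := by
    ext S
    simp only [mem_colorClass, Coloring.toPartial, φ]
    split_ifs with h1 <;> simp_all
  have h2 : colorClass φ.toPartial 2 = (𝓐 ∪ 𝓑)ᶜ := by
    ext S
    simp only [mem_colorClass, Coloring.toPartial, φ]
    split_ifs with h1 <;> simp_all
  refine ⟨φ, h0, h1, h2, fun hs => ?_⟩
  obtain ⟨f, hf, hinc⟩ := (hasStrongRainbowAntichain_iff _).1 hs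
  have ha := mem_colorClass.2 (hf 0)
  have hb := mem_colorClass.2 (hf 1)
  rw [h0] at ha
  rw [h1] at hb
  have := hinc 0 1 (by simp)
  have := h _ ha _ hb
  unfold Incomp at *
  tauto

theorem RainbowFree.mem_of_incomp {n : ℕ} {𝓐 𝓑 𝓒 : Finset (B n)} (h : RainbowFree 𝓐 𝓑 𝓒)
    {a b S : B n} (ha : a ∈ 𝓐) (hb : b ∈ 𝓑) (hab : Incomp a b) (hSa : Incomp S a)
    (hSb : Incomp S b) : S ∈ 𝓐 ∨ S ∈ 𝓑 := by
  rcases h.cover S with h1 | h1 | h1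
  · exact Or.inl h1
  · exact Or.inr h1
  · exact (h.free a ha b hb S h1 hab hSa.symm hSb.symm).elim

theorem RainbowFree.subset_of_incomp {n : ℕ} {𝓐 𝓑 𝓒 : Finset (B n)} (h : RainbowFree 𝓐 𝓑 𝓒)
    {a b : B n} (ha : a ∈ 𝓐) (hb : b ∈ 𝓑) (hab : Incomp a b) :
    𝓒 ⊆ (Iic a ∪ Ici a) ∪ (Iic b ∪ Ici b) := by
  intro S hS
  by_contra hcon
  simp only [mem_union, mem_Iic, mem_Ici, not_or] at hcon
  exact h.free a ha b hb S hS hab ⟨hcon.1.2, hcon.1.1⟩ ⟨hcon.2.2, hcon.2.1⟩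

/-! ### Sizes -/

theorem card_Iic_eq {n : ℕ} (Y : B n) : (Iic Y).card = 2 ^ Y.card := card_Iic_finset

theorem card_Ici_eq {n : ℕ} (Z : B n) : (Ici Z).card = 2 ^ (Zᶜ).card := by
  have e : Ici Z = Icc Z univ := by ext; simp
  rw [e, card_Icc_finset (subset_univ Z)]
  have := card_compl_add Z
  congr 1
  simp
  omega

theorem two_pow_add_le {n s : ℕ} (h1 : 3 ≤ s) (h2 : s + 3 ≤ n) :
    2 ^ s + 2 ^ (n - s) ≤ 2 ^ (n - 3) + 8 := by
  obtain ⟨i, rfl⟩ := Nat.exists_eq_add_of_le h1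
  obtain ⟨j, rfl⟩ := Nat.exists_eq_add_of_le h2
  -- By convexity the extremes `s = 3` and `s = n - 3` are worst; the inequality is `(2 ^ i - 1) (2
  -- ^ j - 1) ≥ 0`.
  rw [show 3 + i + 3 + j - (3 + i) = j + 3 by omega, show 3 + i + 3 + j - 3 = i + j + 3 by omega,
    pow_add, pow_add 2 j, pow_add 2 (i + j), pow_add 2 i]
  have hi := Nat.one_le_two_pow (n := i)
  have hj := Nat.one_le_two_pow (n := j)
  nlinarith

theorem card_extreme_le {n : ℕ} :
    (univ.filter fun S : B n => ¬ (3 ≤ S.card ∧ S.card + 3 ≤ n)).card ≤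
      2 * (1 + n + n.choose 2) := by
  have hsub : (univ.filter fun S : B n => ¬ (3 ≤ S.card ∧ S.card + 3 ≤ n)) ⊆
      (powersetCard 0 univ ∪ powersetCard 1 univ ∪ powersetCard 2 univ) ∪
      (powersetCard 0 univ ∪ powersetCard 1 univ ∪ powersetCard 2 univ).image compl := by
    intro S hS
    have hc := card_compl_add S
    simp only [mem_filter, mem_univ, true_and] at hS
    by_cases h : S.card < 3
    · refine mem_union_left _ ?_
      simp only [mem_union, mem_powersetCard, subset_univ, true_and]
      omega
    · refine mem_union_right _ (mem_image.2 ⟨Sᶜ, ?_, compl_compl S⟩)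
      simp only [mem_union, mem_powersetCard, subset_univ, true_and]
      omega
  have hL : (powersetCard 0 univ ∪ powersetCard 1 univ ∪ powersetCard 2 univ :
      Finset (B n)).card ≤ 1 + n + n.choose 2 := by
    refine (card_union_le _ _).trans (Nat.add_le_add ((card_union_le _ _).trans ?_) ?_)
    · simp
    · simp
  have h1 := (card_le_card hsub).trans (card_union_le _ _)
  have h2 := h1.trans (Nat.add_le_add_left card_image_le _)
  omega

/-- This is the source of the bound `18`: the inequality fails for `n = 17`. The summand `32` leaves
room for `2 ^ 4 + 2 ^ 4` in `card_lt_of_outside_interval`. -/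
theorem extreme_lt_two_pow {n : ℕ} (hn : 18 ≤ n) :
    2 * (1 + n + n.choose 2) + 32 < 2 ^ (n / 2) := by
  have key : ∀ k, 9 ≤ k → 4 * k ^ 2 + 6 * k + 36 < 2 ^ k := by
    intro k hk
    induction k, hk using Nat.le_induction with
    | base => norm_num
    | succ k hk ih => rw [pow_succ 2 k]; nlinarith
  have h1 := key (n / 2) (by omega)
  have h2 : n.choose 2 ≤ (2 * (n / 2) + 1).choose 2 := Nat.choose_le_choose 2 (by omega)
  have h3 : (2 * (n / 2) + 1).choose 2 = (2 * (n / 2) + 1) * (n / 2) := by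
    rw [Nat.choose_two_right]
    simp only [Nat.add_sub_cancel]
    rw [show (2 * (n / 2) + 1) * (2 * (n / 2)) = (2 * (n / 2) + 1) * (n / 2) * 2 by ring]
    exact Nat.mul_div_cancel _ (by norm_num)
  have h4 : n ≤ 2 * (n / 2) + 1 := by omega
  nlinarith

theorem two_pow_le_of_two_mul_le {n m : ℕ} (h : 2 * m ≤ n) : 2 ^ m ≤ 2 ^ (n / 2) :=
  Nat.pow_le_pow_right (by norm_num) (by omega)

/-- If, up to three extreme levels on each side, a sixteenth of the lattice lies inside
`[∅, Y] ∪ [Y, Z] ∪ [Z, [n]]`, then families inside `[∅, Y] ∪ [Z, [n]]` are small. -/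
theorem card_lt_of_outside_interval {n : ℕ} (hn : 18 ≤ n) {𝓐 : Finset (B n)} {Y Z P Q : B n}
    (hYZ : Y ⊆ Z) (hY : 2 * Y.card ≤ n) (hZ : 2 * (Zᶜ).card ≤ n) (hPQ : P ⊆ Q)
    (hP : P.card ≤ 2) (hQ : (Qᶜ).card ≤ 2)
    (hI : ∀ S ∈ Icc P Q, (3 ≤ S.card ∧ S.card + 3 ≤ n) → S ⊆ Y ∨ Z ⊆ S ∨ Y ⊂ S ∧ S ⊂ Z)
    (hA : ∀ S ∈ 𝓐, (3 ≤ S.card ∧ S.card + 3 ≤ n) → S ⊆ Y ∨ Z ⊆ S) :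
    𝓐.card < 2 ^ (n / 2) := by
  let E := univ.filter fun S : B n => ¬ (3 ≤ S.card ∧ S.card + 3 ≤ n)
  have hE : E.card + 32 < 2 ^ (n / 2) := by
    have h1 := card_extreme_le (n := n)
    have h2 := extreme_lt_two_pow hn
    exact lt_of_le_of_lt (Nat.add_le_add_right h1 _) h2
  have p1 := card_compl_add P
  have q1 := card_compl_add Q
  have y1 := card_compl_add Y
  have z1 := card_compl_add Z
  have pq := card_le_card hPQ
  have yz := card_le_card hYZ
  have hbig : 2 ^ (n - 4) ≤ (Icc P Q).card := by
    rw [card_Icc_finset hPQ]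
    exact Nat.pow_le_pow_right (by norm_num) (by omega)
  have hIsub : Icc P Q ⊆ (Iic Y ∪ Ici Z) ∪ (Icc Y Z ∪ E) := by
    intro S hS
    simp only [mem_union, mem_Iic, mem_Ici, mem_Icc, E, mem_filter, mem_univ, true_and]
    by_cases hm : 3 ≤ S.card ∧ S.card + 3 ≤ n
    · rcases hI S hS hm with h | h | h
      · tauto
      · tauto
      · exact Or.inr (Or.inl ⟨h.1.subset, h.2.subset⟩)
    · tauto
  have hAsub : 𝓐 ⊆ (Iic Y ∪ Ici Z) ∪ E := by
    intro S hS
    simp only [mem_union, mem_Iic, mem_Ici, E, mem_filter, mem_univ, true_and]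
    by_cases hm : 3 ≤ S.card ∧ S.card + 3 ≤ n
    · exact Or.inl (hA S hS hm)
    · exact Or.inr hm
  have hYZc : (Iic Y ∪ Ici Z).card ≤ 2 ^ Y.card + 2 ^ (Zᶜ).card := by
    rw [← card_Iic_eq, ← card_Ici_eq]; exact card_union_le _ _
  have hAc := (card_le_card hAsub).trans (card_union_le _ _)
  have hIc := (card_le_card hIsub).trans (card_union_le _ _)
  have hIc2 := card_union_le (Icc Y Z) E
  rw [card_Icc_finset hYZ] at hIc2
  -- If `|Y| + |Zᶜ| ≥ 5`, then `[Y, Z]` has at most `2 ^ (n - 5)` sets and the rest fewer than `3 *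
  -- 2 ^ (n / 2)`, which cannot cover the `2 ^ (n - 4)` sets of `[P, Q]`.
  by_cases hr : Y.card + (Zᶜ).card ≤ 4
  · have a1 : 2 ^ Y.card ≤ 2 ^ 4 := Nat.pow_le_pow_right (by norm_num) (by omega)
    have a2 : 2 ^ (Zᶜ).card ≤ 2 ^ 4 := Nat.pow_le_pow_right (by norm_num) (by omega)
    omega
  · exfalso
    have a1 := two_pow_le_of_two_mul_le hY
    have a2 := two_pow_le_of_two_mul_le hZ
    have a3 : 2 ^ (Z.card - Y.card) ≤ 2 ^ (n - 5) :=
      Nat.pow_le_pow_right (by norm_num) (by omega)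
    have a4 : 2 ^ (n / 2 + 2) ≤ 2 ^ (n - 5) := Nat.pow_le_pow_right (by norm_num) (by omega)
    rw [pow_add] at a4
    rw [show n - 4 = n - 5 + 1 by omega, pow_succ] at hbig
    omega

theorem RainbowFree.specialPair_of_card {n : ℕ} (hn : 18 ≤ n) {𝓐 𝓑 𝓒 : Finset (B n)}
    (h : RainbowFree 𝓐 𝓑 𝓒) (hA : 2 ^ (n / 2) ≤ 𝓐.card) (hB : 2 ^ (n / 2) ≤ 𝓑.card)
    (hC : 2 ^ n ≤ 3 * 𝓒.card) {a b : B n} (ha : a ∈ 𝓐) (hb : b ∈ 𝓑) (hab : Incomp a b) :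
    SpecialPair a b := by
  by_contra hs
  let mid : B n → Prop := fun S => 3 ≤ S.card ∧ S.card + 3 ≤ n
  have hcross : CrossComparable (𝓐.filter mid) (𝓑.filter mid) := by
    intro a ha b hb
    rw [mem_filter] at ha hb
    by_contra hcon
    push Not at hcon
    have h1 := card_le_card (h.subset_of_incomp ha.1 hb.1 hcon)
    have h2 := h1.trans ((card_union_le _ _).trans
      (Nat.add_le_add (card_union_le _ _) (card_union_le _ _)))
    rw [card_Iic_eq, card_Ici_eq, card_Iic_eq, card_Ici_eq] at h2
    have a1 := card_compl_add a
    have b1 := card_compl_add b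
    have a2 := two_pow_add_le ha.2.1 ha.2.2
    have b2 := two_pow_add_le hb.2.1 hb.2.2
    rw [show (aᶜ).card = n - a.card by omega, show (bᶜ).card = n - b.card by omega] at h2
    have h3 : 2 ^ 15 ≤ 2 ^ (n - 3) := Nat.pow_le_pow_right (by norm_num) (by omega)
    have h4 : 2 ^ n = 2 ^ (n - 3) * 8 := by
      rw [show (8 : ℕ) = 2 ^ 3 by norm_num, ← pow_add]; congr 1; omega
    omega
  obtain ⟨P, Q, hPQ, hP, hQ, hS⟩ := hab.exists_interval hs
  obtain ⟨Y, Z, hYZ, hY, hZ, hAB, hor⟩ := hcross.exists_interval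
  have hI : ∀ S ∈ Icc P Q, mid S → S ⊆ Y ∨ Z ⊆ S ∨ Y ⊂ S ∧ S ⊂ Z := by
    intro S hmem hm
    refine hAB S ?_
    rw [← filter_union, mem_filter, mem_union]
    exact ⟨h.mem_of_incomp ha hb hab (hS S hmem).1 (hS S hmem).2, hm⟩
  rcases hor with hor | hor
  · exact absurd hA (not_le.2 (card_lt_of_outside_interval hn hYZ hY hZ hPQ hP hQ hI
      fun S hS hm => hor S (mem_filter.2 ⟨hS, hm⟩)))
  · exact absurd hB (not_le.2 (card_lt_of_outside_interval hn hYZ hY hZ hPQ hP hQ hI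
      fun S hS hm => hor S (mem_filter.2 ⟨hS, hm⟩)))

/-- Since `Y ⊂ Z`, the sizes `|Y|` and `|Zᶜ|` sum to less than `n`. If one is below `n / 2`, its
family is too small. Otherwise `n` is odd, both equal `n / 2` rounded down and `|Z \ Y| = 1`; there
the summand `2 * (n % 2)` gives the contradiction. -/
theorem not_mem_of_card {n : ℕ} (hn : 18 ≤ n) {𝓐 𝓑 : Finset (B n)}
    (hd : Disjoint 𝓐 𝓑) (hs : ∀ a ∈ 𝓐, ∀ b ∈ 𝓑, Incomp a b → SpecialPair a b)
    (hA : 2 ^ (n / 2) + 2 * (n % 2) ≤ 𝓐.card) (hB : 2 ^ (n / 2) + 2 * (n % 2) ≤ 𝓑.card)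
    {x : Fin n} (hx : {x} ∈ 𝓐) : {x}ᶜ ∉ 𝓑 := by
  intro hx'
  obtain ⟨Y, Z, hYZ, hAsub, hBsub⟩ := exists_interval_of_specialPair (by omega) hd hs hx hx'
  have hw : (Z \ Y).card = Z.card - Y.card := card_sdiff_of_subset hYZ.subset
  have hlt := card_lt_card hYZ
  have z1 := card_compl_add Z
  have hAc : 𝓐.card ≤ 2 ^ Y.card + (Z \ Y).card + 1 := by
    refine (card_le_card hAsub).trans ((card_insert_le _ _).trans (Nat.add_le_add_right ?_ 1))
    rw [← card_Iic_eq]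
    exact (card_union_le _ _).trans (Nat.add_le_add_left card_image_le _)
  have hBc : 𝓑.card ≤ 2 ^ (Zᶜ).card + (Z \ Y).card + 1 := by
    refine (card_le_card hBsub).trans ((card_insert_le _ _).trans (Nat.add_le_add_right ?_ 1))
    rw [← card_Ici_eq]
    exact (card_union_le _ _).trans (Nat.add_le_add_left card_image_le _)
  -- In the union, `∅` and `univ` are already counted in `Iic Y` and `Ici Z`, so the two extra ones
  -- disappear.
  have hABc : 𝓐.card + 𝓑.card ≤
      (2 ^ Y.card + (Z \ Y).card) + (2 ^ (Zᶜ).card + (Z \ Y).card) := by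
    rw [← card_union_of_disjoint hd]
    have hsub : 𝓐 ∪ 𝓑 ⊆ (Iic Y ∪ (Z \ Y).image fun p => {p}) ∪
        (Ici Z ∪ (Z \ Y).image fun p => {p}ᶜ) := by
      refine union_subset (hAsub.trans ?_) (hBsub.trans ?_)
      · refine insert_subset ?_ subset_union_left
        simp
      · refine insert_subset ?_ subset_union_right
        simp
    refine (card_le_card hsub).trans ((card_union_le _ _).trans (Nat.add_le_add ?_ ?_))
    · rw [← card_Iic_eq]
      exact (card_union_le _ _).trans (Nat.add_le_add_left card_image_le _)
    · rw [← card_Ici_eq]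
      exact (card_union_le _ _).trans (Nat.add_le_add_left card_image_le _)
  have hbig := extreme_lt_two_pow hn
  have hch : n ≤ n.choose 2 := by
    rw [Nat.choose_two_right, Nat.le_div_iff_mul_le (by norm_num)]
    exact Nat.mul_le_mul_left n (by omega)
  have hdouble : 2 ^ (n / 2) = 2 * 2 ^ (n / 2 - 1) := by
    rw [← pow_succ']; congr 1; omega
  by_cases h1 : Y.card ≤ n / 2 - 1
  · have : 2 ^ Y.card ≤ 2 ^ (n / 2 - 1) := Nat.pow_le_pow_right (by norm_num) h1
    omega
  by_cases h2 : (Zᶜ).card ≤ n / 2 - 1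
  · have : 2 ^ (Zᶜ).card ≤ 2 ^ (n / 2 - 1) := Nat.pow_le_pow_right (by norm_num) h2
    omega
  have e1 : Y.card = n / 2 := by omega
  have e2 : (Zᶜ).card = n / 2 := by omega
  rw [e1, e2] at hABc
  omega

theorem RainbowFree.crossComparable_of_card {n : ℕ} (hn : 18 ≤ n) {𝓐 𝓑 𝓒 : Finset (B n)}
    (h : RainbowFree 𝓐 𝓑 𝓒) (hA : 2 ^ (n / 2) + 2 * (n % 2) ≤ 𝓐.card)
    (hB : 2 ^ (n / 2) + 2 * (n % 2) ≤ 𝓑.card) (hC : 2 ^ n ≤ 3 * 𝓒.card) :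
    CrossComparable 𝓐 𝓑 := by
  intro a ha b hb
  by_contra hcon
  push Not at hcon
  have hs : ∀ a ∈ 𝓐, ∀ b ∈ 𝓑, Incomp a b → SpecialPair a b := fun a ha b hb hab =>
    h.specialPair_of_card hn (by omega) (by omega) hC ha hb hab
  obtain ⟨x, ⟨rfl, rfl⟩ | ⟨rfl, rfl⟩⟩ := hs a ha b hb hcon
  · exact not_mem_of_card hn h.disjoint_left hs hA hB ha hb
  · exact not_mem_of_card hn h.disjoint_left.symm
      (fun b hb a ha hab => (hs a ha b hb hab.symm).symm) hB hA hb ha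

theorem not_mem_partialSizeThresholds {n m : ℕ} {𝓐 𝓑 : Finset (B n)} (hd : Disjoint 𝓐 𝓑)
    (h : CrossComparable 𝓐 𝓑) (hA : m ≤ 𝓐.card) (hB : m ≤ 𝓑.card) :
    m ∉ partialSizeThresholds n 2 := by
  intro hm
  obtain ⟨φ, h0, h1, hφ⟩ := exists_partialColoring hd h
  refine hφ (hm φ fun i => ?_)
  fin_cases i
  · simpa [h0] using hA
  · simpa [h1] using hB

theorem not_mem_sizeThresholds {n m : ℕ} {𝓐 𝓑 : Finset (B n)} (hd : Disjoint 𝓐 𝓑)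
    (h : CrossComparable 𝓐 𝓑) (hA : m ≤ 𝓐.card) (hB : m ≤ 𝓑.card)
    (hC : m ≤ ((𝓐 ∪ 𝓑)ᶜ).card) : m ∉ sizeThresholds n 3 := by
  intro hm
  obtain ⟨φ, h0, h1, h2, hφ⟩ := exists_coloring hd h
  refine hφ (hm φ fun i => ?_)
  fin_cases i
  · simpa [h0] using hA
  · simpa [h1] using hB
  · exact hC.trans_eq (congrArg card h2.symm)

/-- The extremal pair consists of the sets below and strictly above one set of size `n / 2`. For odd
`n` the upper family has room to spare and hands `univ` to the lower one. The smaller family then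
has size one less than the bound. -/
theorem le_FPartial {n : ℕ} (hn : 18 ≤ n) : 2 ^ (n / 2) + 2 * (n % 2) ≤ FPartial n 2 := by
  by_contra hcon
  have hmem : FPartial n 2 ∈ partialSizeThresholds n 2 :=
    Nat.sInf_mem (partialSizeThresholds_nonempty n 2 (by norm_num))
  obtain ⟨X, -, hX⟩ := exists_subset_card_eq (s := (univ : B n)) (n := n / 2) (by simp; omega)
  have hXc := card_compl_add X
  have hpow : 2 ^ 9 ≤ 2 ^ (n / 2) := Nat.pow_le_pow_right (by norm_num) (by omega)
  have hXu : X ≠ univ := by rintro rfl; simp at hX; omega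
  rcases Nat.mod_two_eq_zero_or_one n with hpar | hpar
  · have hd : Disjoint (Iic X) ((Ici X).erase X) := by
      rw [Finset.disjoint_left]
      intro S h1 h2
      simp only [mem_Iic, mem_erase, mem_Ici] at h1 h2
      exact h2.1 (Subset.antisymm h1 h2.2)
    refine not_mem_partialSizeThresholds hd ?_ ?_ ?_ hmem
    · intro S hS T hT
      simp only [mem_Iic, mem_erase, mem_Ici] at hS hT
      exact Or.inl (hS.trans hT.2)
    · rw [card_Iic_eq, hX]; omega
    · rw [card_erase_of_mem (by simp), card_Ici_eq, show (Xᶜ).card = n / 2 by omega]; omega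
  · have hd : Disjoint (insert univ (Iic X)) (((Ici X).erase X).erase univ) := by
      rw [Finset.disjoint_left]
      intro S h1 h2
      simp only [mem_insert, mem_Iic, mem_erase, mem_Ici] at h1 h2
      rcases h1 with h1 | h1
      · exact h2.1 h1
      · exact h2.2.1 (Subset.antisymm h1 h2.2.2)
    refine not_mem_partialSizeThresholds hd ?_ ?_ ?_ hmem
    · intro S hS T hT
      simp only [mem_insert, mem_Iic, mem_erase, mem_Ici] at hS hT
      rcases hS with rfl | hS
      · exact Or.inr (subset_univ T)
      · exact Or.inl (hS.trans hT.2.2)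
    · rw [card_insert_of_notMem (by simpa using hXu), card_Iic_eq, hX]; omega
    · rw [card_erase_of_mem (by simp [ssubset_univ_iff, hXu]), card_erase_of_mem (by simp), card_Ici_eq,
        show (Xᶜ).card = n / 2 + 1 by omega, pow_succ]
      omega

theorem CrossComparable.card_le {n m : ℕ} {𝓐 𝓑 : Finset (B n)} (h : CrossComparable 𝓐 𝓑)
    (hA : m ≤ 𝓐.card) (hB : m ≤ 𝓑.card) : m ≤ 2 * 2 ^ (n / 2) := by
  obtain ⟨Y, Z, -, hY, hZ, -, hor⟩ := h.exists_interval
  have a1 := two_pow_le_of_two_mul_le hY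
  have a2 := two_pow_le_of_two_mul_le hZ
  have key : ∀ 𝓕 : Finset (B n), (∀ T ∈ 𝓕, T ⊆ Y ∨ Z ⊆ T) → 𝓕.card ≤ 2 * 2 ^ (n / 2) := by
    intro 𝓕 hF
    have hsub : 𝓕 ⊆ Iic Y ∪ Ici Z := fun T hT => by simpa using hF T hT
    have := (card_le_card hsub).trans (card_union_le _ _)
    rw [card_Iic_eq, card_Ici_eq] at this
    omega
  rcases hor with hor | hor
  · exact hA.trans (key _ hor)
  · exact hB.trans (key _ hor)

theorem exists_max_color {M : Type*} [LinearOrder M] (f : Fin 3 → M) :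
    ∃ i j l : Fin 3, i ≠ j ∧ i ≠ l ∧ j ≠ l ∧ ∀ t, f t ≤ f l := by
  obtain ⟨l, hl⟩ := Finite.exists_max f
  have : ∀ l : Fin 3, ∃ i j, i ≠ j ∧ i ≠ l ∧ j ≠ l := by decide
  obtain ⟨i, j, h1, h2, h3⟩ := this l
  exact ⟨i, j, l, h1, h2, h3, hl⟩

theorem F_eq_FPartial {n : ℕ} (hn : 18 ≤ n) : F n 3 = FPartial n 2 := by
  apply le_antisymm
  · refine Nat.sInf_le fun φ hφ => ?_
    by_contra hcon
    obtain ⟨i, j, l, hij, hil, hjl, hmax⟩ :=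
      exists_max_color fun i => (colorClass φ.toPartial i).card
    have hrf := rainbowFree_colorClass hcon hij hil hjl
    have hle := le_FPartial hn
    have hC : 2 ^ n ≤ 3 * (colorClass φ.toPartial l).card := by
      have hsub : (univ : Finset (B n)) ⊆ colorClass φ.toPartial i ∪ colorClass φ.toPartial j ∪
          colorClass φ.toPartial l := by
        intro S _
        have := hrf.cover S
        simp only [mem_union]
        tauto
      have h1 := (card_le_card hsub).trans ((card_union_le _ _).trans
        (Nat.add_le_add_right (card_union_le _ _) _))
      have h2 : (univ : Finset (B n)).card = 2 ^ n := by simp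
      have := hmax i
      have := hmax j
      omega
    exact not_mem_partialSizeThresholds hrf.disjoint_left
      (hrf.crossComparable_of_card hn (hle.trans (hφ i)) (hle.trans (hφ j)) hC) (hφ i) (hφ j)
      (Nat.sInf_mem (partialSizeThresholds_nonempty n 2 (by norm_num)))
  · refine Nat.sInf_le fun φ hφ => ?_
    by_contra hcon
    have hcross := crossComparable_colorClass hcon
    have hF := hcross.card_le (hφ 0) (hφ 1)
    -- Both classes are trimmed to exactly `F n 3` sets, so that the third class, everything else,
    -- has at least as many.
    obtain ⟨𝓐, hAsub, hA⟩ := exists_subset_card_eq (hφ 0)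
    obtain ⟨𝓑, hBsub, hB⟩ := exists_subset_card_eq (hφ 1)
    have hd : Disjoint 𝓐 𝓑 := (disjoint_colorClass φ (by simp)).mono hAsub hBsub
    refine not_mem_sizeThresholds hd (hcross.mono hAsub hBsub) hA.ge hB.ge ?_
      (Nat.sInf_mem (sizeThresholds_nonempty n 3 (by norm_num)))
    rw [card_compl, card_union_of_disjoint hd, hA, hB]
    have h1 : 2 ^ (n / 2 + 3) ≤ 2 ^ n := Nat.pow_le_pow_right (by norm_num) (by omega)
    rw [pow_add] at h1
    simp only [Fintype.card_finset, Fintype.card_fin]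
    change F n 3 ≤ _
    change F n 3 ≤ _ at hF
    omega

/-! ### Lubell masses of cross-comparable pairs -/

/-- Here `u` and `v` stand for `|Y|` and `|Zᶜ|`, and `w` for the mass gained from singletons or
their complements, each set size being relative to `n + 1`. With `h1` as constraint, the total mass
cannot exceed `2 + 2√2`. -/
theorem two_add_two_sqrt_two_bound {u v w : ℝ} (hu : 0 ≤ u) (huv : u ≤ v) (hw : 0 ≤ w)
    (hsum : u + v + w ≤ 1) (hv1 : v < 1) (h1 : √2 < 1 / (1 - u) + w)
    (h3 : 2 + 2 * √2 < 1 / (1 - u) + 1 / (1 - v) + 2 * w) : False := by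
  have r2 : √2 * √2 = 2 := Real.mul_self_sqrt (by norm_num)
  have rlo : (1.414 : ℝ) < √2 := by rw [Real.lt_sqrt] <;> norm_num
  have rhi : √2 < (1.415 : ℝ) := by rw [Real.sqrt_lt] <;> norm_num
  obtain ⟨s, hs⟩ : ∃ s, s = 1 - u := ⟨_, rfl⟩
  obtain ⟨t, ht⟩ : ∃ t, t = 1 - v := ⟨_, rfl⟩
  rw [← hs] at h1
  rw [← hs, ← ht] at h3
  have ht0 : 0 < t := by linarith
  have hs0 : 0 < s := by linarith
  -- For large `w`, the bound `s * t ≥ s + t - 1` with `s + t ≥ 1 + w` gives `1 / s + 1 / t ≤ (1 +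
  -- w) / w`, and crude numerics suffice.
  by_cases hw4 : 2 / 5 < w
  · have hst : s + t - 1 ≤ s * t := by nlinarith
    have hb : 1 / s + 1 / t ≤ (1 + w) / w := by
      rw [div_add_div _ _ hs0.ne' ht0.ne', div_le_div_iff₀ (by positivity) (by linarith)]
      nlinarith
    have hc : (1 + w) / w + 2 * w ≤ 4.5 := by
      have : (1 + w) / w ≤ 4.5 - 2 * w := by
        rw [div_le_iff₀ (by linarith)]; nlinarith
      linarith
    linarith
  · push Not at hw4
    -- For small `w`, eliminating `t` by `t ≥ 1 + w - s` turns the goal into a quadratic in `x = 1 /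
    -- s` being nonpositive. The constraint gives `x > q`, and `u ≤ v` gives `x ≤ p`. The quadratic
    -- is convex, so the endpoints `q` and `p` suffice.
    obtain ⟨x, hx⟩ : ∃ x, x = 1 / s := ⟨_, rfl⟩
    obtain ⟨q, hq⟩ : ∃ q, q = √2 - w := ⟨_, rfl⟩
    obtain ⟨p, hp⟩ : ∃ p, p = 2 / (1 + w) := ⟨_, rfl⟩
    have hxs : x * s = 1 := by rw [hx]; field_simp
    have hpw : p * (1 + w) = 2 := by rw [hp]; field_simp
    have hqx : q < x := by rw [hq, hx]; linarith
    have hxp : x ≤ p := by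
      rw [hx, hp, div_le_div_iff₀ hs0 (by linarith)]; linarith
    have hK : 2 + 2 * √2 - 2 * w = 2 + 2 * q := by rw [hq]; ring
    have fq : (1 + w) * q ^ 2 - (2 + 2 * q) * (1 + w) * q + (2 + 2 * q) ≤ 0 := by
      have e : (1 + w) * q ^ 2 - (2 + 2 * q) * (1 + w) * q + (2 + 2 * q) =
          w * (-2 + w + 2 * √2 * w - w ^ 2) := by
        rw [hq]; linear_combination (-1 - w) * r2
      rw [e]
      have : -2 + w + 2 * √2 * w - w ^ 2 ≤ 0 := by nlinarith
      nlinarith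
    have fp : (1 + w) * p ^ 2 - (2 + 2 * q) * (1 + w) * p + (2 + 2 * q) ≤ 0 := by
      have e : (1 + w) * p ^ 2 - (2 + 2 * q) * (1 + w) * p + (2 + 2 * q) = 2 * p - (2 + 2 * q) := by
        linear_combination (p - (2 + 2 * q)) * hpw
      have : p ≤ 1 + q := by
        rw [hp, div_le_iff₀ (by linarith), hq]; nlinarith
      linarith
    have fx : (1 + w) * x ^ 2 - (2 + 2 * q) * (1 + w) * x + (2 + 2 * q) ≤ 0 := by
      have hpq : 0 < p - q := by linarith
      have e : ((1 + w) * x ^ 2 - (2 + 2 * q) * (1 + w) * x + (2 + 2 * q)) * (p - q) =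
          ((1 + w) * q ^ 2 - (2 + 2 * q) * (1 + w) * q + (2 + 2 * q)) * (p - x) +
          ((1 + w) * p ^ 2 - (2 + 2 * q) * (1 + w) * p + (2 + 2 * q)) * (x - q) -
          (1 + w) * (p - q) * (x - q) * (p - x) := by ring
      have t1 : 0 ≤ (1 + w) * (p - q) * (x - q) * (p - x) :=
        mul_nonneg (mul_nonneg (mul_nonneg (by linarith) hpq.le) (by linarith)) (by linarith)
      have t2 := mul_nonpos_of_nonpos_of_nonneg fq (show 0 ≤ p - x by linarith)
      have t3 := mul_nonpos_of_nonpos_of_nonneg fp (show 0 ≤ x - q by linarith)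
      by_contra hcon
      push Not at hcon
      have := mul_pos hcon hpq
      linarith
    have hd : 0 < (1 + w) * x - 1 := by
      have : 1 < x := by linarith
      nlinarith
    have htx : 1 / t ≤ x / ((1 + w) * x - 1) := by
      rw [div_le_div_iff₀ ht0 hd]
      nlinarith
    have hfin : x + x / ((1 + w) * x - 1) ≤ 2 + 2 * q := by
      have : x / ((1 + w) * x - 1) ≤ 2 + 2 * q - x := by
        rw [div_le_iff₀ hd]; nlinarith
      linarith
    rw [← hx] at h3
    linarith

theorem lubell_bound_false {u v w : ℝ} (hu : 0 ≤ u) (hv : 0 ≤ v) (hw : 0 ≤ w)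
    (hsum : u + v + w ≤ 1) (hu1 : u < 1) (hv1 : v < 1) (h1 : √2 < 1 / (1 - u) + w)
    (h2 : √2 < 1 / (1 - v) + w)
    (h3 : 2 + 2 * √2 < 1 / (1 - u) + 1 / (1 - v) + 2 * w) : False := by
  rcases le_total u v with h | h
  · exact two_add_two_sqrt_two_bound hu h hw hsum hv1 h1 h3
  · exact two_add_two_sqrt_two_bound hv h hw (by linarith) hu1 h2 (by linarith)

theorem div_sub_eq {N k : ℝ} (hN : 0 < N) : N / (N - k) = 1 / (1 - k / N) := by
  rw [one_sub_div hN.ne', one_div_div]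

theorem lubellMass_insert_univ_le {n : ℕ} (𝓕 : Finset (B n)) :
    lubellMass (insert univ 𝓕) ≤ 1 + lubellMass 𝓕 := by
  simpa using lubellMass_insert_le univ 𝓕

theorem lubellMass_insert_empty_le {n : ℕ} (𝓕 : Finset (B n)) :
    lubellMass (insert ∅ 𝓕) ≤ 1 + lubellMass 𝓕 := by
  simpa using lubellMass_insert_le ∅ 𝓕

theorem one_add_sqrt_two_gt : (2.414 : ℝ) < 1 + √2 := by
  have : (1.414 : ℝ) < √2 := by rw [Real.lt_sqrt] <;> norm_num
  linarith

/-- The case `w = 0`, where all sets are comparable with one set. The larger of the two fractions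
exceeds `√2` automatically. -/
theorem lubell_two_chain_false {n k : ℕ} (hn : 10 ≤ n) (hk : 2 * k ≤ n) {p q : ℝ}
    (hp : 1 + √2 < p) (hq : 1 + √2 < q) (hq1 : q ≤ 1 + (n + 1) / (n + 1 - k : ℝ))
    (hpq : p + q ≤ (n + 1) / (n + 1 - k : ℝ) + (n + 1) / (n + 1 - (n - k : ℝ))) : False := by
  have hN : (0 : ℝ) < n + 1 := by positivity
  have hk' : (2 * k : ℝ) ≤ n := by exact_mod_cast hk
  have hn' : (10 : ℝ) ≤ n := by exact_mod_cast hn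
  have hk0 : (0 : ℝ) ≤ k := by positivity
  have rhi : √2 < (1.415 : ℝ) := by rw [Real.sqrt_lt] <;> norm_num
  refine lubell_bound_false (u := k / (n + 1)) (v := (n - k) / (n + 1)) (w := 0) (by positivity)
    (div_nonneg (by linarith) hN.le) le_rfl ?_ ?_ ?_ ?_ ?_ ?_
  · rw [← add_div, add_zero, div_le_one hN]; linarith
  · rw [div_lt_one hN]; linarith
  · rw [div_lt_one hN]; linarith
  · rw [← div_sub_eq hN]; linarith
  · rw [← div_sub_eq hN, add_zero]
    refine rhi.trans_le ?_
    rw [le_div_iff₀ (by linarith)]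
    linarith
  · rw [← div_sub_eq hN, ← div_sub_eq hN]; linarith

theorem CrossComparable.lubellMass_false_of_interval {n : ℕ} (hn : 100 ≤ n) {𝓐 𝓑 : Finset (B n)}
    (hd : Disjoint 𝓐 𝓑) {Y Z : B n} (hYZ : Y ⊆ Z) (hY : 2 * Y.card ≤ n) (hZ : 2 * (Zᶜ).card ≤ n)
    (hAB : ∀ T ∈ 𝓐 ∪ 𝓑, T ⊆ Y ∨ Z ⊆ T ∨ Y ⊂ T ∧ T ⊂ Z) (hB : ∀ T ∈ 𝓑, T ⊆ Y ∨ Z ⊆ T)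
    (h1 : 1 + √2 < lubellMass 𝓐) (h2 : 1 + √2 < lubellMass 𝓑) : False := by
  have hg := one_add_sqrt_two_gt
  have hsum := lubellMass_union hd
  have hnR : (100 : ℝ) ≤ n := by exact_mod_cast hn
  by_cases hy0 : Y.card = 0
  · obtain rfl := card_eq_zero.1 hy0
    have hz1 : (Z.card : ℝ) = n - (Zᶜ).card := by
      rw [eq_sub_iff_add_eq]; exact_mod_cast card_compl_add Z
    have hBsub : 𝓑 ⊆ insert ∅ (Ici Z) := fun T hT => by
      have := hB T hT; simpa using this
    have hABsub : 𝓐 ∪ 𝓑 ⊆ Iic Z ∪ Ici Z := fun T hT => by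
      rw [mem_union, mem_Iic, mem_Ici]
      rcases hAB T hT with h | h | h
      · exact Or.inl (h.trans (empty_subset Z))
      · exact Or.inr h
      · exact Or.inl h.2.subset
    have e1 := (lubellMass_mono hBsub).trans (lubellMass_insert_empty_le _)
    have e2 := (lubellMass_mono hABsub).trans (lubellMass_union_le _ _)
    rw [lubellMass_Ici] at e1 e2
    rw [lubellMass_Iic, hz1] at e2
    exact lubell_two_chain_false (by omega) hZ h1 h2 e1 (by linarith)
  by_cases hz0 : (Zᶜ).card = 0
  · have : Z = univ := by rwa [card_eq_zero, compl_eq_empty_iff] at hz0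
    subst this
    have hy1 : ((Yᶜ).card : ℝ) = n - Y.card := by
      rw [eq_sub_iff_add_eq, add_comm]; exact_mod_cast card_compl_add Y
    have hBsub : 𝓑 ⊆ insert univ (Iic Y) := fun T hT => by
      have := hB T hT; simp at this; simp; tauto
    have hABsub : 𝓐 ∪ 𝓑 ⊆ Iic Y ∪ Ici Y := fun T hT => by
      rw [mem_union, mem_Iic, mem_Ici]
      rcases hAB T hT with h | h | h
      · exact Or.inl h
      · exact Or.inr ((subset_univ Y).trans h)
      · exact Or.inr h.1.subset
    have e1 := (lubellMass_mono hBsub).trans (lubellMass_insert_univ_le _)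
    have e2 := (lubellMass_mono hABsub).trans (lubellMass_union_le _ _)
    rw [lubellMass_Iic] at e1 e2
    rw [lubellMass_Ici, hy1] at e2
    exact lubell_two_chain_false (by omega) hY h1 h2 e1 (by linarith)
  have hBsub : 𝓑 ⊆ Iic Y ∪ Ici Z := fun T hT => by
    have := hB T hT; simpa using this
  have hABsub : 𝓐 ∪ 𝓑 ⊆ Iic Y ∪ Ici Z ∪ Icc Y Z := fun T hT => by
    rw [mem_union, mem_union, mem_Iic, mem_Ici, mem_Icc]
    rcases hAB T hT with h | h | h
    · exact Or.inl (Or.inl h)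
    · exact Or.inl (Or.inr h)
    · exact Or.inr ⟨h.1.subset, h.2.subset⟩
  have e1 := (lubellMass_mono hBsub).trans (lubellMass_union_le _ _)
  have e2 := (lubellMass_mono hABsub).trans ((lubellMass_union_le _ _).trans
    (add_le_add_left (lubellMass_union_le _ _) _))
  have e3 := lubellMass_Icc_mul_le Y Z (by omega) (by omega)
  have hYR : (2 * Y.card : ℝ) ≤ n := by exact_mod_cast hY
  have hZR : (2 * (Zᶜ).card : ℝ) ≤ n := by exact_mod_cast hZ
  have hy1 : (1 : ℝ) ≤ Y.card := by exact_mod_cast Nat.one_le_iff_ne_zero.2 hy0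
  have hz1 : (1 : ℝ) ≤ (Zᶜ).card := by exact_mod_cast Nat.one_le_iff_ne_zero.2 hz0
  rw [lubellMass_Iic, lubellMass_Ici] at e1 e2
  generalize (Y.card : ℝ) = y at *
  generalize ((Zᶜ).card : ℝ) = c at *
  generalize lubellMass (Icc Y Z) = M at *
  have b1 : ((n : ℝ) + 1) / (n + 1 - y) ≤ 2 := by rw [div_le_iff₀ (by linarith)]; linarith
  have b2 : ((n : ℝ) + 1) / (n + 1 - c) ≤ 2 := by rw [div_le_iff₀ (by linarith)]; linarith
  -- The ideal and the filter weigh at most 2 each, so `[Y, Z]` must carry the rest. By `e3` this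
  -- makes `y + c` small compared with `n`, hence ideal and filter weigh at most 1.2 each, and `𝓑`
  -- at most 2.4.
  have hM : 0.8 < M := by linarith
  have hr : 6 * (y + c) ≤ n + 1 := by
    by_contra hcon
    push Not at hcon
    have h8 : 0.8 * ((y + c) * (y + c + 1)) ≤ M * ((y + c) * (y + c + 1)) :=
      mul_le_mul_of_nonneg_right hM.le (by positivity)
    have h9 : 0.8 * (y + c + 1) < 6 := by
      by_contra hcon'
      push Not at hcon'
      have := mul_le_mul_of_nonneg_left hcon' (show 0 ≤ y + c by linarith)
      linarith
    linarith
  have b3 : ((n : ℝ) + 1) / (n + 1 - y) ≤ 1.2 := by rw [div_le_iff₀ (by linarith)]; linarith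
  have b4 : ((n : ℝ) + 1) / (n + 1 - c) ≤ 1.2 := by rw [div_le_iff₀ (by linarith)]; linarith
  linarith

theorem CrossComparable.lubellMass_false {n : ℕ} (hn : 100 ≤ n) {𝓐 𝓑 : Finset (B n)}
    (hd : Disjoint 𝓐 𝓑) (h : CrossComparable 𝓐 𝓑) (h1 : 1 + √2 < lubellMass 𝓐)
    (h2 : 1 + √2 < lubellMass 𝓑) : False := by
  obtain ⟨Y, Z, hYZ, hY, hZ, hAB, hor | hor⟩ := h.exists_interval
  · rw [union_comm] at hAB
    exact lubellMass_false_of_interval hn hd.symm hYZ hY hZ hAB hor h2 h1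
  · exact lubellMass_false_of_interval hn hd hYZ hY hZ hAB hor h1 h2

theorem not_mem_of_lubellMass {n : ℕ} (hn : 3 ≤ n) {𝓐 𝓑 : Finset (B n)}
    (hd : Disjoint 𝓐 𝓑) (hs : ∀ a ∈ 𝓐, ∀ b ∈ 𝓑, Incomp a b → SpecialPair a b)
    (h1 : 1 + √2 < lubellMass 𝓐) (h2 : 1 + √2 < lubellMass 𝓑)
    {x : Fin n} (hx : {x} ∈ 𝓐) : {x}ᶜ ∉ 𝓑 := by
  intro hx'
  obtain ⟨Y, Z, hYZ, hAsub, hBsub⟩ := exists_interval_of_specialPair hn hd hs hx hx'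
  have hw : Y.card + (Zᶜ).card + (Z \ Y).card = n := by
    have := card_sdiff_add_card_eq_card hYZ.subset
    have := card_compl_add Z
    omega
  have i1 : lubellMass ((Z \ Y).image fun p => {p}) ≤ (Z \ Y).card / n := by
    refine (lubellMass_le_card_div _ ?_).trans ?_
    · intro S hS
      obtain ⟨p, -, rfl⟩ := mem_image.1 hS
      simp
    · gcongr; exact card_image_le
  have i2 : lubellMass ((Z \ Y).image fun p => {p}ᶜ) ≤ (Z \ Y).card / n := by
    refine (lubellMass_le_card_div _ ?_).trans ?_
    · intro S hS
      obtain ⟨p, -, rfl⟩ := mem_image.1 hS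
      right; simp [card_compl]; omega
    · gcongr; exact card_image_le
  have e1 : lubellMass 𝓐 ≤ 1 + (lubellMass (Iic Y) + (Z \ Y).card / n) :=
    (lubellMass_mono hAsub).trans ((lubellMass_insert_univ_le _).trans
      (add_le_add_right ((lubellMass_union_le _ _).trans (add_le_add_right i1 _)) _))
  have e2 : lubellMass 𝓑 ≤ 1 + (lubellMass (Ici Z) + (Z \ Y).card / n) :=
    (lubellMass_mono hBsub).trans ((lubellMass_insert_empty_le _).trans
      (add_le_add_right ((lubellMass_union_le _ _).trans (add_le_add_right i2 _)) _))
  have e3 : lubellMass 𝓐 + lubellMass 𝓑 ≤ (lubellMass (Iic Y) + (Z \ Y).card / n) +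
      (lubellMass (Ici Z) + (Z \ Y).card / n) := by
    rw [← lubellMass_union hd]
    have hsub : 𝓐 ∪ 𝓑 ⊆ (Iic Y ∪ (Z \ Y).image fun p => {p}) ∪
        (Ici Z ∪ (Z \ Y).image fun p => {p}ᶜ) := by
      refine union_subset (hAsub.trans ?_) (hBsub.trans ?_)
      · refine insert_subset ?_ subset_union_left
        simp
      · refine insert_subset ?_ subset_union_right
        simp
    exact (lubellMass_mono hsub).trans ((lubellMass_union_le _ _).trans
      (add_le_add ((lubellMass_union_le _ _).trans (add_le_add_right i1 _))
        ((lubellMass_union_le _ _).trans (add_le_add_right i2 _))))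
  rw [lubellMass_Iic] at e1 e3
  rw [lubellMass_Ici] at e2 e3
  have hwR : (Y.card + (Zᶜ).card + (Z \ Y).card : ℝ) = n := by exact_mod_cast hw
  have hy0 : (0 : ℝ) ≤ Y.card := by positivity
  have hc0 : (0 : ℝ) ≤ (Zᶜ).card := by positivity
  have hw0 : (0 : ℝ) ≤ (Z \ Y).card := by positivity
  have hn0 : (3 : ℝ) ≤ n := by exact_mod_cast hn
  generalize (Y.card : ℝ) = y at *
  generalize ((Zᶜ).card : ℝ) = c at *
  generalize ((Z \ Y).card : ℝ) = w at *
  have hN : (0 : ℝ) < n + 1 := by linarith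
  -- Passing from `w / n` to `(w + 1) / (n + 1)` makes the three parameters sum to exactly 1.
  have hwn : w / n ≤ (w + 1) / (n + 1) := by
    rw [div_le_div_iff₀ (by linarith) hN]; linarith
  refine lubell_bound_false (u := y / (n + 1)) (v := c / (n + 1)) (w := (w + 1) / (n + 1))
    (by positivity) (by positivity) (by positivity) ?_ ?_ ?_ ?_ ?_ ?_
  · rw [← add_div, ← add_div, div_le_one hN]; linarith
  · rw [div_lt_one hN]; linarith
  · rw [div_lt_one hN]; linarith
  · rw [← div_sub_eq hN]; linarith
  · rw [← div_sub_eq hN]; linarith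
  · rw [← div_sub_eq hN, ← div_sub_eq hN]; linarith

/-! ### Lubell masses of rainbow-free partitions -/

/-- The set is on none of the lowest or highest 31 levels. -/
def IsMiddle {n : ℕ} (S : B n) : Prop := 31 ≤ S.card ∧ S.card + 31 ≤ n

theorem exists_isMiddle {n : ℕ} (hn : 100 ≤ n) {P R : B n} (hd : Disjoint P R) (hP : P.card ≤ 2)
    (hR : R.card ≤ 2) : ∃ S, IsMiddle S ∧ P ⊆ S ∧ Disjoint S R := by
  have hc := card_compl_add R
  obtain ⟨S, h1, h2, h3⟩ := exists_subsuperset_card_eq (subset_compl_iff_disjoint_right.2 hd)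
    (show P.card ≤ 31 by omega) (show 31 ≤ (Rᶜ).card by omega)
  exact ⟨S, ⟨h3.ge, by omega⟩, h1, subset_compl_iff_disjoint_right.1 h2⟩

theorem IsMiddle.incomp_of_card_lt {n : ℕ} {S b : B n} (hS : IsMiddle S) (hb : b.card < 31)
    {x : Fin n} (hx : x ∈ b) (hxS : x ∉ S) : Incomp S b :=
  ⟨fun h => by have := card_le_card h; have := hS.1; omega, fun h => hxS (h hx)⟩

theorem IsMiddle.incomp_of_lt_card {n : ℕ} {S b : B n} (hS : IsMiddle S) (hb : n < b.card + 31)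
    {x : Fin n} (hx : x ∉ b) (hxS : x ∈ S) : Incomp S b :=
  ⟨fun h => hx (h hxS), fun h => by have := card_le_card h; have := hS.2; omega⟩

/-- A set missing some `s ∈ L` and containing some `t ∉ U` is incomparable with both `L` and `U`.
Since `b` is on an extreme level, one more element suffices for `b`: one of `b \ U` to leave out if
`b` is small, one of `L \ b` to include if `b` is large. -/
theorem exists_isMiddle_incomp {n : ℕ} (hn : 100 ≤ n) {L U b : B n} (hL : IsMiddle L)
    (hU : IsMiddle U) (hLU : L ⊆ U) (hb : ¬ IsMiddle b) (hbL : Incomp b L) (hbU : Incomp b U) :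
    ∃ R, IsMiddle R ∧ Incomp R L ∧ Incomp R U ∧ Incomp R b := by
  have hUc := card_compl_add U
  have hL1 := hL.1
  have hU2 := hU.2
  have key : ∀ R : B n, ∀ s ∈ L, s ∉ R → ∀ t ∈ R, t ∉ U → Incomp R L ∧ Incomp R U :=
    fun R s hs hsR t ht htU => ⟨⟨fun h => htU (hLU (h ht)), fun h => hsR (h hs)⟩,
      fun h => htU (h ht), fun h => hsR (h (hLU hs))⟩
  rcases not_and_or.1 hb with hb | hb
  · obtain ⟨x, hxb, hxU⟩ := not_subset.1 hbU.1
    obtain ⟨s, hs⟩ : L.Nonempty := card_pos.1 (by omega)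
    obtain ⟨t, ht, htx⟩ := exists_mem_ne (s := Uᶜ) (by omega) x
    rw [mem_compl] at ht
    have hts : t ≠ s := fun e => ht (hLU (e ▸ hs))
    obtain ⟨R, hR, hP, hQ⟩ := exists_isMiddle hn (P := {t}) (R := {x, s}) (by simp [htx, hts])
      (by simp) card_le_two
    simp only [disjoint_insert_right, disjoint_singleton_right, singleton_subset_iff] at hP hQ
    have := key R s hs hQ.2 t hP ht
    exact ⟨R, hR, this.1, this.2, hR.incomp_of_card_lt (by omega) hxb hQ.1⟩
  · obtain ⟨x, hxL, hxb⟩ := not_subset.1 hbL.2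
    obtain ⟨s, hs, hsx⟩ := exists_mem_ne (s := L) (by omega) x
    obtain ⟨t, ht⟩ : (Uᶜ).Nonempty := card_pos.1 (by omega)
    rw [mem_compl] at ht
    have hts : t ≠ s := fun e => ht (hLU (e ▸ hs))
    obtain ⟨R, hR, hP, hQ⟩ := exists_isMiddle hn (P := {x, t}) (R := {s}) (by simp [hsx, hts.symm])
      card_le_two (by simp)
    simp only [disjoint_singleton_right, insert_subset_iff, singleton_subset_iff] at hP hQ
    have := key R s hs hQ t hP.2 ht
    exact ⟨R, hR, this.1, this.2, hR.incomp_of_lt_card (by omega) hxb hP.1⟩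

/-- A middle set must miss an element of each small set and contain a non-element of each large one.
These demands conflict only for `{x}` and `{x}ᶜ`. -/
theorem exists_isMiddle_incomp_or_specialPair {n : ℕ} (hn : 100 ≤ n) {b b' : B n}
    (hb : ¬ IsMiddle b) (hb' : ¬ IsMiddle b') (h0 : b ≠ ∅) (h1 : b ≠ univ) (h0' : b' ≠ ∅)
    (h1' : b' ≠ univ) : (∃ R, IsMiddle R ∧ Incomp R b ∧ Incomp R b') ∨ SpecialPair b b' := by
  have mixed : ∀ b b' : B n, b ≠ ∅ → b' ≠ univ → b.card < 31 → n < b'.card + 31 →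
      (∃ R, IsMiddle R ∧ Incomp R b ∧ Incomp R b') ∨ SpecialPair b b' := by
    intro b b' h0 h1' hb hb'
    by_cases hex : ∃ x ∈ b, ∃ z, z ∉ b' ∧ x ≠ z
    · obtain ⟨x, hx, z, hz, hxz⟩ := hex
      obtain ⟨R, hR, hP, hQ⟩ := exists_isMiddle hn (P := {z}) (R := {x}) (by simp [hxz.symm])
        (by simp) (by simp)
      simp only [disjoint_singleton_right, singleton_subset_iff] at hP hQ
      exact Or.inl ⟨R, hR, hR.incomp_of_card_lt hb hx hQ, hR.incomp_of_lt_card hb' hz hP⟩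
    · push Not at hex
      obtain ⟨x, hx⟩ := nonempty_iff_ne_empty.2 h0
      obtain ⟨z, hz⟩ : ∃ z, z ∉ b' := by simpa [eq_univ_iff_forall] using h1'
      obtain rfl := hex x hx z hz
      refine Or.inr ⟨x, Or.inl ⟨eq_singleton_iff_unique_mem.2 ⟨hx, fun y hy => hex y hy x hz⟩, ?_⟩⟩
      rw [eq_compl_comm, eq_comm, eq_singleton_iff_unique_mem]
      simp only [mem_compl]
      exact ⟨hz, fun y hy => (hex x hx y hy).symm⟩
  rcases not_and_or.1 hb with hb | hb <;> rcases not_and_or.1 hb' with hb' | hb'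
  · obtain ⟨x, hx⟩ := nonempty_iff_ne_empty.2 h0
    obtain ⟨y, hy⟩ := nonempty_iff_ne_empty.2 h0'
    obtain ⟨R, hR, -, hQ⟩ := exists_isMiddle hn (P := ∅) (R := {x, y}) (by simp)
        (by simp) card_le_two
    simp only [disjoint_insert_right, disjoint_singleton_right] at hQ
    exact Or.inl ⟨R, hR, hR.incomp_of_card_lt (by omega) hx hQ.1,
      hR.incomp_of_card_lt (by omega) hy hQ.2⟩
  · exact mixed b b' h0 h1' (by omega) (by omega)
  · rcases mixed b' b h0' h1 (by omega) (by omega) with ⟨R, hR, hR1, hR2⟩ | h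
    · exact Or.inl ⟨R, hR, hR2, hR1⟩
    · exact Or.inr h.symm
  · obtain ⟨x, hx⟩ : ∃ z, z ∉ b := by simpa [eq_univ_iff_forall] using h1
    obtain ⟨y, hy⟩ : ∃ z, z ∉ b' := by simpa [eq_univ_iff_forall] using h1'
    obtain ⟨R, hR, hP, -⟩ := exists_isMiddle hn (P := {x, y}) (R := ∅) (by simp)
        card_le_two (by simp)
    simp only [insert_subset_iff, singleton_subset_iff] at hP
    exact Or.inl ⟨R, hR, hR.incomp_of_lt_card (by omega) hx hP.1,
      hR.incomp_of_lt_card (by omega) hy hP.2⟩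

/-- If one part has no middle sets, then around each of its members the middle sets are in only
one other part. -/
theorem RainbowFree.false_of_isMiddle {n : ℕ} (hn : 100 ≤ n) {𝓐 𝓑 𝓒 : Finset (B n)}
    (h : RainbowFree 𝓐 𝓑 𝓒) (hB : ∀ T ∈ 𝓑, ¬ IsMiddle T) {b S T : B n} (hb : b ∈ 𝓑)
    (hS : S ∈ 𝓐) (hT : T ∈ 𝓒) (hSm : IsMiddle S) (hTm : IsMiddle T) (hbS : Incomp b S)
    (hbT : Incomp b T) : False := by
  have key : ∀ R, IsMiddle R → Incomp R S → Incomp R T → Incomp R b → False := by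
    intro R hR hRS hRT hRb
    rcases h.cover R with hm | hm | hm
    · exact h.free R hm b hb T hT hRb hRT hbT
    · exact hB R hm hR
    · exact h.free S hS b hb R hm hbS.symm hRS.symm hRb.symm
  by_cases hST : Incomp S T
  · exact h.free S hS b hb T hT hbS.symm hST hbT
  · rcases not_and_or.1 hST with h1 | h1
    · obtain ⟨R, hR, h2, h3, h4⟩ :=
        exists_isMiddle_incomp hn hSm hTm (not_not.1 h1) (hB b hb) hbS hbT
      exact key R hR h2 h3 h4
    · obtain ⟨R, hR, h2, h3, h4⟩ :=
        exists_isMiddle_incomp hn hTm hSm (not_not.1 h1) (hB b hb) hbT hbS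
      exact key R hR h3 h2 h4

theorem lubellMass_le_of_isMiddle {n : ℕ} {𝓕 𝓖 : Finset (B n)}
    (h : ∀ S ∈ 𝓕, IsMiddle S → S ∈ 𝓖) : lubellMass 𝓕 ≤ lubellMass 𝓖 + 62 := by
  have hsub : 𝓕 ⊆ 𝓖 ∪ ((univ.filter fun S : B n => S.card < 31) ∪
      (univ.filter fun S : B n => n < S.card + 31)) := by
    intro S hS
    simp only [mem_union, mem_filter, mem_univ, true_and]
    by_cases hm : IsMiddle S
    · exact Or.inl (h S hS hm)
    · unfold IsMiddle at hm; right; omega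
  have h1 := lubellMass_union_le (univ.filter fun S : B n => S.card < 31)
    (univ.filter fun S : B n => n < S.card + 31)
  have h2 := (lubellMass_mono hsub).trans (lubellMass_union_le _ _)
  have h3 := lubellMass_card_lt (n := n) 31
  have h4 := lubellMass_lt_card (n := n) 31
  push_cast at h3 h4
  linarith

/-- If `|Y| + |Zᶜ| ≥ 30`, then `[Y, Z]` has mass at most `(n + 1) / 31`, while `[P, Q]` has at least
`(n + 1) / 30`. For `n ≥ 100000` the gap exceeds the mass `4 + 62` of ideal, filter and extreme
levels. So `Y` and `Zᶜ` have at most 29 elements, below the middle levels. -/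
theorem not_isMiddle_of_interval {n : ℕ} (hn : 100000 ≤ n) {𝓑 : Finset (B n)} {Y Z P Q : B n}
    (hY : 2 * Y.card ≤ n) (hZ : 2 * (Zᶜ).card ≤ n) (hPQ : P ⊆ Q)
    (hP : P.card ≤ 2) (hQ : (Qᶜ).card ≤ 2)
    (hI : ∀ S ∈ Icc P Q, IsMiddle S → S ⊆ Y ∨ Z ⊆ S ∨ Y ⊂ S ∧ S ⊂ Z)
    (hB : ∀ S ∈ 𝓑, IsMiddle S → S ⊆ Y ∨ Z ⊆ S) : ∀ T ∈ 𝓑, ¬ IsMiddle T := by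
  have h1 := le_lubellMass_Icc hPQ hP hQ
  have h2 := lubellMass_le_of_isMiddle (𝓕 := Icc P Q) (𝓖 := (Iic Y ∪ Ici Z) ∪ Icc Y Z) (by
    intro S hS hm
    simp only [mem_union, mem_Iic, mem_Ici, mem_Icc]
    rcases hI S hS hm with h | h | h
    · tauto
    · tauto
    · exact Or.inr ⟨h.1.subset, h.2.subset⟩)
  have h3 := lubellMass_union_le (Iic Y ∪ Ici Z) (Icc Y Z)
  have h4 := lubellMass_union_le (Iic Y) (Ici Z)
  have h5 := lubellMass_Icc_le Y Z
  rw [lubellMass_Iic, lubellMass_Ici] at h4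
  have hYR : (2 * Y.card : ℝ) ≤ n := by exact_mod_cast hY
  have hZR : (2 * (Zᶜ).card : ℝ) ≤ n := by exact_mod_cast hZ
  have hnR : (100000 : ℝ) ≤ n := by exact_mod_cast hn
  have b1 : ((n : ℝ) + 1) / (n + 1 - Y.card) ≤ 2 := by rw [div_le_iff₀ (by linarith)]; linarith
  have b2 : ((n : ℝ) + 1) / (n + 1 - (Zᶜ).card) ≤ 2 := by
    rw [div_le_iff₀ (by linarith)]; linarith
  have hr : Y.card + (Zᶜ).card ≤ 29 := by
    by_contra hcon
    have hcon' : (30 : ℝ) ≤ Y.card + (Zᶜ).card := by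
      exact_mod_cast (show 30 ≤ Y.card + (Zᶜ).card by omega)
    have b3 : ((n : ℝ) + 1) / (Y.card + (Zᶜ).card + 1) ≤ (n + 1) / 31 := by
      gcongr; linarith
    linarith
  intro T hT hm
  have z1 := card_compl_add Z
  have m1 := hm.1
  have m2 := hm.2
  rcases hB T hT hm with h | h
  · have := card_le_card h; omega
  · have := card_le_card h; omega

/-- The middle sets around `b` belong to `𝓐` only, and this spreads to every other `b' ∈ 𝓑`, except
`∅`, `univ` and the special partner of `b`, through a middle set incomparable with both. So the
middle part of `𝓒` lies above all small and below all large such `b'`, in an interval `[W, V]`. As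
`𝓒` has a third of the mass, `|W| + |Vᶜ| ≤ 2`, so `𝓑` is little more than a tiny ideal and a tiny
filter. -/
theorem RainbowFree.lubellMass_le_of_not_isMiddle {n : ℕ} (hn : 100000 ≤ n)
    {𝓐 𝓑 𝓒 : Finset (B n)} (h : RainbowFree 𝓐 𝓑 𝓒) (hB : ∀ T ∈ 𝓑, ¬ IsMiddle T)
    (hC : (n + 1) / 3 ≤ lubellMass 𝓒) {a b : B n} (ha : a ∈ 𝓐) (hb : b ∈ 𝓑)
    (hab : Incomp a b) (hs : ¬ SpecialPair a b) : lubellMass 𝓑 ≤ 2.4 := by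
  classical
  have hnR : (100000 : ℝ) ≤ n := by exact_mod_cast hn
  obtain ⟨P, Q, hPQ, hP, hQ, hS⟩ := hab.exists_interval hs
  have hbC : ∀ T ∈ 𝓒, IsMiddle T → ¬ Incomp b T := by
    intro T hT hTm hbT
    obtain ⟨S, hSm, h1, h2⟩ := exists_isMiddle (by omega : 100 ≤ n)
      (subset_compl_iff_disjoint_right.1 ((compl_compl Q).symm ▸ hPQ)) hP hQ
    obtain ⟨hSa, hSb⟩ := hS S
      (mem_Icc.2 ⟨h1, by rw [← compl_compl Q]; exact subset_compl_iff_disjoint_right.2 h2⟩)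
    rcases h.mem_of_incomp ha hb hab hSa hSb with hm | hm
    · exact h.false_of_isMiddle (by omega) hB hb hm hT hSm hTm hSb.symm hbT
    · exact hB S hm hSm
  have hb0 : b ≠ ∅ := by rintro rfl; exact hab.2 (empty_subset a)
  have hb1 : b ≠ univ := by rintro rfl; exact hab.1 (subset_univ a)
  have htype : ∀ b' ∈ 𝓑, b' ≠ ∅ → b' ≠ univ → ¬ SpecialPair b b' →
      ∀ T ∈ 𝓒, IsMiddle T → ¬ Incomp b' T := by
    intro b' hb' h0 h1 hsp T hT hTm hbT
    obtain ⟨R, hR, hRb, hRb'⟩ := (exists_isMiddle_incomp_or_specialPair (by omega) (hB b hb)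
      (hB b' hb') hb0 hb1 h0 h1).resolve_right hsp
    rcases h.cover R with hm | hm | hm
    · exact h.false_of_isMiddle (by omega) hB hb' hm hT hR hTm hRb'.symm hbT
    · exact hB R hm hR
    · exact hbC R hm hR hRb.symm
  let p : B n → Prop := fun b' => b' ≠ ∅ ∧ b' ≠ univ ∧ ¬ SpecialPair b b'
  let W := (𝓑.filter fun b' => p b' ∧ b'.card < 31).sup id
  let V := (𝓑.filter fun b' => p b' ∧ n < b'.card + 31).inf id
  have hCsub : ∀ T ∈ 𝓒, IsMiddle T → T ∈ Icc W V := by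
    intro T hT hTm
    rw [mem_Icc]
    constructor
    · refine Finset.sup_le fun b' hb' => ?_
      obtain ⟨hb', ⟨h0, h1, hsp⟩, hc⟩ := mem_filter.1 hb'
      have := htype b' hb' h0 h1 hsp T hT hTm
      by_contra hcon
      exact this ⟨hcon, fun hle => by have := card_le_card hle; have := hTm.1; omega⟩
    · refine Finset.le_inf fun b' hb' => ?_
      obtain ⟨hb', ⟨h0, h1, hsp⟩, hc⟩ := mem_filter.1 hb'
      have := htype b' hb' h0 h1 hsp T hT hTm
      by_contra hcon
      exact this ⟨fun hle => by have := card_le_card hle; have := hTm.2; omega, hcon⟩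
  have hCle := (lubellMass_le_of_isMiddle hCsub).trans
    (add_le_add_left (lubellMass_Icc_le W V) _)
  have hr : W.card + (Vᶜ).card ≤ 2 := by
    by_contra hcon
    have hcon' : (3 : ℝ) ≤ W.card + (Vᶜ).card := by
      exact_mod_cast (show 3 ≤ W.card + (Vᶜ).card by omega)
    have b3 : ((n : ℝ) + 1) / (W.card + (Vᶜ).card + 1) ≤ (n + 1) / 4 := by
      gcongr; linarith
    linarith
  have hWR : (W.card : ℝ) ≤ 2 := by exact_mod_cast (show W.card ≤ 2 by omega)
  have hVR : ((Vᶜ).card : ℝ) ≤ 2 := by exact_mod_cast (show (Vᶜ).card ≤ 2 by omega)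
  have hsp : lubellMass (𝓑.filter fun b' => SpecialPair b b') ≤ 0.1 := by
    refine (lubellMass_le_card_div _ ?_).trans ?_
    · intro S hS
      obtain ⟨x, ⟨-, rfl⟩ | ⟨-, rfl⟩⟩ := (mem_filter.1 hS).2
      · right; simp [card_compl]; omega
      · left; simp
    · have hc : (𝓑.filter fun b' => SpecialPair b b').card ≤ 1 := by
        refine card_le_one.2 fun S hS T hT => ?_
        have key : ∀ S, SpecialPair b S → S = bᶜ := by
          rintro S ⟨x, ⟨rfl, rfl⟩ | ⟨rfl, rfl⟩⟩ <;> simp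
        rw [key S (mem_filter.1 hS).2, key T (mem_filter.1 hT).2]
      have hc' : ((𝓑.filter fun b' => SpecialPair b b').card : ℝ) ≤ 1 := by exact_mod_cast hc
      rw [div_le_iff₀ (by linarith)]
      linarith
  have hBsub : 𝓑 ⊆ (𝓑.filter fun b' => SpecialPair b b') ∪ (Iic W ∪ Ici V) := by
    intro S hS
    rw [mem_union, mem_union, mem_filter, mem_Iic, mem_Ici]
    by_cases h0 : S = ∅
    · subst h0; exact Or.inr (Or.inl (empty_subset W))
    by_cases h1 : S = univ
    · subst h1; exact Or.inr (Or.inr (subset_univ V))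
    by_cases h2 : SpecialPair b S
    · exact Or.inl ⟨hS, h2⟩
    rcases not_and_or.1 (hB S hS) with h3 | h3
    · exact Or.inr (Or.inl (le_sup (f := id)
        (mem_filter.2 ⟨hS, (⟨h0, h1, h2⟩ : p S), by omega⟩)))
    · exact Or.inr (Or.inr (inf_le (f := id)
        (mem_filter.2 ⟨hS, (⟨h0, h1, h2⟩ : p S), by omega⟩)))
  have e1 := (lubellMass_mono hBsub).trans (lubellMass_union_le _ _)
  have e2 := lubellMass_union_le (Iic W) (Ici V)
  rw [lubellMass_Iic, lubellMass_Ici] at e2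
  have b1 : ((n : ℝ) + 1) / (n + 1 - W.card) ≤ 1.1 := by rw [div_le_iff₀ (by linarith)]; linarith
  have b2 : ((n : ℝ) + 1) / (n + 1 - (Vᶜ).card) ≤ 1.1 := by
    rw [div_le_iff₀ (by linarith)]; linarith
  linarith

theorem RainbowFree.specialPair_of_lubellMass {n : ℕ} (hn : 100000 ≤ n) {𝓐 𝓑 𝓒 : Finset (B n)}
    (h : RainbowFree 𝓐 𝓑 𝓒) (hA : 2.4 < lubellMass 𝓐) (hB : 2.4 < lubellMass 𝓑)
    (hC : (n + 1) / 3 ≤ lubellMass 𝓒) {a b : B n} (ha : a ∈ 𝓐) (hb : b ∈ 𝓑)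
    (hab : Incomp a b) : SpecialPair a b := by
  classical
  by_contra hs
  have hnR : (100000 : ℝ) ≤ n := by exact_mod_cast hn
  have hcross : CrossComparable (𝓐.filter IsMiddle) (𝓑.filter IsMiddle) := by
    intro a ha b hb
    rw [mem_filter] at ha hb
    by_contra hcon
    push Not at hcon
    have h1 := lubellMass_mono (h.subset_of_incomp ha.1 hb.1 hcon)
    have h2 := lubellMass_union_le (Iic a ∪ Ici a) (Iic b ∪ Ici b)
    -- Two such unions have total mass at most `(n + 1) / 8`, too little to contain `𝓒`.
    have key : ∀ S : B n, IsMiddle S → lubellMass (Iic S ∪ Ici S) ≤ (n + 1) / 16 := by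
      intro S hS
      have e := lubellMass_union_le (Iic S) (Ici S)
      have s1 : (31 : ℝ) ≤ S.card := by exact_mod_cast hS.1
      have s2 : (S.card + 31 : ℝ) ≤ n := by exact_mod_cast hS.2
      have s3 : (S.card + (Sᶜ).card : ℝ) = n := by exact_mod_cast card_compl_add S
      rw [lubellMass_Iic, lubellMass_Ici] at e
      have e1 : ((n : ℝ) + 1) / (n + 1 - S.card) ≤ (n + 1) / 32 := by gcongr; linarith
      have e2 : ((n : ℝ) + 1) / (n + 1 - (Sᶜ).card) ≤ (n + 1) / 32 := by gcongr; linarith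
      linarith
    have h3 := key a ha.2
    have h4 := key b hb.2
    linarith
  obtain ⟨P, Q, hPQ, hP, hQ, hS⟩ := hab.exists_interval hs
  obtain ⟨Y, Z, hYZ, hY, hZ, hAB, hor⟩ := hcross.exists_interval
  have hI : ∀ S ∈ Icc P Q, IsMiddle S → S ⊆ Y ∨ Z ⊆ S ∨ Y ⊂ S ∧ S ⊂ Z := by
    intro S hmem hm
    refine hAB S ?_
    rw [← filter_union, mem_filter, mem_union]
    exact ⟨h.mem_of_incomp ha hb hab (hS S hmem).1 (hS S hmem).2, hm⟩
  rcases hor with hor | hor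
  · have := h.swap.lubellMass_le_of_not_isMiddle hn (not_isMiddle_of_interval hn hY hZ hPQ hP hQ hI
      fun S hS hm => hor S (mem_filter.2 ⟨hS, hm⟩)) hC hb ha hab.symm fun h => hs h.symm
    linarith
  · have := h.lubellMass_le_of_not_isMiddle hn (not_isMiddle_of_interval hn hY hZ hPQ hP hQ hI
      fun S hS hm => hor S (mem_filter.2 ⟨hS, hm⟩)) hC ha hb hab hs
    linarith

theorem RainbowFree.lubellMass_false {n : ℕ} (hn : 100000 ≤ n) {𝓐 𝓑 𝓒 : Finset (B n)}
    (h : RainbowFree 𝓐 𝓑 𝓒) (hA : 1 + √2 < lubellMass 𝓐) (hB : 1 + √2 < lubellMass 𝓑)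
    (hC : (n + 1) / 3 ≤ lubellMass 𝓒) : False := by
  have hg := one_add_sqrt_two_gt
  have hs : ∀ a ∈ 𝓐, ∀ b ∈ 𝓑, Incomp a b → SpecialPair a b := fun a ha b hb hab =>
    h.specialPair_of_lubellMass hn (by linarith) (by linarith) hC ha hb hab
  refine CrossComparable.lubellMass_false (by omega) h.disjoint_left ?_ hA hB
  intro a ha b hb
  by_contra hcon
  push Not at hcon
  obtain ⟨x, ⟨rfl, rfl⟩ | ⟨rfl, rfl⟩⟩ := hs a ha b hb hcon
  · exact not_mem_of_lubellMass (by omega) h.disjoint_left hs hA hB ha hb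
  · exact not_mem_of_lubellMass (by omega) h.disjoint_left.symm
      (fun b hb a ha hab => (hs a ha b hb hab.symm).symm) hB hA hb ha

/-! ### Limits -/

theorem GPartial_le {n : ℕ} (hn : 100 ≤ n) : GPartial n 2 ≤ 1 + √2 := by
  -- The margin `ε` turns the lower bounds on the masses into the strict ones needed.
  refine le_of_forall_pos_le_add fun ε hε => csInf_le
    (partialMassThresholds_bddBelow n 2 le_rfl) fun φ hφ => ?_
  by_contra hcon
  have h0 := hφ 0
  have h1 := hφ 1
  exact (crossComparable_colorClass hcon).lubellMass_false hn (disjoint_colorClass φ (by simp))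
    (by linarith) (by linarith)

theorem G_le {n : ℕ} (hn : 100000 ≤ n) : G n 3 ≤ 1 + √2 := by
  refine le_of_forall_pos_le_add fun ε hε => csInf_le
    (massThresholds_bddBelow n 3 (by norm_num)) fun φ hφ => ?_
  by_contra hcon
  obtain ⟨i, j, l, hij, hil, hjl, hmax⟩ :=
    exists_max_color fun i => lubellMass (colorClass φ.toPartial i)
  have hrf := rainbowFree_colorClass hcon hij hil hjl
  have hsub : (univ : Finset (B n)) ⊆ colorClass φ.toPartial i ∪ colorClass φ.toPartial j ∪
      colorClass φ.toPartial l := by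
    intro S _
    have := hrf.cover S
    simp only [mem_union]
    tauto
  have h1 := (lubellMass_mono hsub).trans ((lubellMass_union_le _ _).trans
    (add_le_add_left (lubellMass_union_le _ _) _))
  rw [lubellMass_univ] at h1
  have m1 := hmax i
  have m2 := hmax j
  have c1 := hφ i
  have c2 := hφ j
  exact hrf.lubellMass_false hn (by linarith) (by linarith) (by linarith)

theorem exists_crossComparable {n k : ℕ} (hk : 1 ≤ k) (hkn : k < n) :
    ∃ 𝓐 𝓑 : Finset (B n), Disjoint 𝓐 𝓑 ∧ CrossComparable 𝓐 𝓑 ∧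
      (n + 1) / (k + 1 : ℝ) - 1 - 1 / n ≤ lubellMass 𝓐 ∧
      lubellMass 𝓑 = 1 + (n + 1) / (n + 1 - k : ℝ) ∧
      (n + 1) - (n + 1) / (k + 1 : ℝ) - (1 + (n + 1) / (n + 1 - k : ℝ)) ≤
        lubellMass (𝓐 ∪ 𝓑)ᶜ := by
  obtain ⟨X, -, hX⟩ := exists_subset_card_eq (s := (univ : B n)) (n := k) (by simp; omega)
  have hXc := card_compl_add X
  have hXu : X ≠ univ := by rintro rfl; simp at hX; omega
  have hIci : lubellMass (Ici X) = (n + 1) / (k + 1 : ℝ) := by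
    have : (n : ℝ) = k + (Xᶜ).card := by rw [← hX]; exact_mod_cast hXc.symm
    rw [lubellMass_Ici]
    congr 1
    linarith
  have hd : Disjoint (((Ici X).erase X).erase univ) (insert univ (Iic X)) := by
    rw [Finset.disjoint_left]
    intro S h2 h1
    simp only [mem_insert, mem_Iic, mem_erase, mem_Ici] at h1 h2
    rcases h1 with h1 | h1
    · exact h2.1 h1
    · exact h2.2.1 (Subset.antisymm h1 h2.2.2)
  have hB : lubellMass (insert univ (Iic X)) = 1 + (n + 1) / (n + 1 - k : ℝ) := by
    have hdis : Disjoint {univ} (Iic X) := by simpa [ssubset_univ_iff] using hXu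
    rw [insert_eq, lubellMass_union hdis, lubellMass_singleton, lubellMass_Iic, hX]
    simp
  refine ⟨((Ici X).erase X).erase univ, insert univ (Iic X), hd, ?_, ?_, hB, ?_⟩
  · intro T hT S hS
    simp only [mem_insert, mem_Iic, mem_erase, mem_Ici] at hS hT
    rcases hS with rfl | hS
    · exact Or.inl (subset_univ T)
    · exact Or.inr (hS.trans hT.2.2)
  · have hsub : Ici X ⊆ insert univ (insert X (((Ici X).erase X).erase univ)) := by
      intro S hS
      simp only [mem_insert, mem_erase]
      tauto
    have h1 := (lubellMass_mono hsub).trans ((lubellMass_insert_univ_le _).trans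
      (add_le_add_right (lubellMass_insert_le _ _) _))
    have h2 : 1 / (n.choose X.card : ℝ) ≤ 1 / n := by
      have : n ≤ n.choose X.card := by
        obtain ⟨m, rfl⟩ := Nat.exists_eq_add_of_lt hkn
        have h3 := factorial_mul_factorial_mul_add_le k (m + 1) hk (by omega)
        have h4 := Nat.add_choose_mul_factorial_mul_factorial k (m + 1)
        have h5 : 0 < k.factorial * (m + 1).factorial :=
          Nat.mul_pos (Nat.factorial_pos _) (Nat.factorial_pos _)
        rw [hX, show k + m + 1 = k + (m + 1) by ring]
        refine Nat.le_of_mul_le_mul_right ?_ h5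
        calc _ = k.factorial * (m + 1).factorial * (k + (m + 1)) := mul_comm _ _
          _ ≤ _ := h3
          _ = _ := by rw [← h4, Nat.choose_symm_add, mul_assoc]
      have hn0 : (0 : ℝ) < n := by exact_mod_cast (show 0 < n by omega)
      exact one_div_le_one_div_of_le hn0 (by exact_mod_cast this)
    linarith
  · have hu := lubellMass_univ n
    have hc := lubellMass_union (disjoint_compl_right (a := ((Ici X).erase X).erase univ ∪
      insert univ (Iic X)))
    have hle : lubellMass (((Ici X).erase X).erase univ) ≤ lubellMass (Ici X) :=
      lubellMass_mono ((erase_subset _ _).trans (erase_subset _ _))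
    have e : ∀ 𝓕 : Finset (B n), 𝓕 ∪ 𝓕ᶜ = univ := fun 𝓕 => union_compl 𝓕
    rw [e, lubellMass_union hd] at hc
    linarith

theorem le_G_and_le_GPartial {n k : ℕ} (hk : 1 ≤ k) (hkn : k < n) {γ : ℝ}
    (h1 : γ ≤ (n + 1) / (k + 1 : ℝ) - 1 - 1 / n) (h2 : γ ≤ 1 + (n + 1) / (n + 1 - k : ℝ))
    (h3 : γ ≤ (n + 1) - (n + 1) / (k + 1 : ℝ) - (1 + (n + 1) / (n + 1 - k : ℝ))) :
    γ ≤ G n 3 ∧ γ ≤ GPartial n 2 := by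
  obtain ⟨𝓐, 𝓑, hd, hcross, hA, hB, hC⟩ := exists_crossComparable hk hkn
  constructor
  · refine le_csInf (massThresholds_nonempty n 3 (by norm_num)) fun δ hδ => ?_
    by_contra hlt
    obtain ⟨φ, e0, e1, e2, hφ⟩ := exists_coloring hd hcross
    refine hφ (hδ φ fun i => ?_)
    have : i = 0 ∨ i = 1 ∨ i = 2 := by omega
    rcases this with rfl | rfl | rfl
    · rw [e0]; linarith
    · rw [e1]; linarith
    · rw [e2]; linarith
  · refine le_csInf (partialMassThresholds_nonempty n 2 (by norm_num)) fun δ hδ => ?_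
    by_contra hlt
    obtain ⟨φ, e0, e1, hφ⟩ := exists_partialColoring hd hcross
    refine hφ (hδ φ fun i => ?_)
    have : i = 0 ∨ i = 1 := by omega
    rcases this with rfl | rfl
    · rw [e0]; linarith
    · rw [e1]; linarith

open Filter Topology in
theorem exists_tendsto_lower_bound : ∃ L : ℕ → ℝ, Tendsto L atTop (𝓝 (1 + √2)) ∧
    ∀ᶠ n in atTop, L n ≤ G n 3 ∧ L n ≤ GPartial n 2 := by
  have r2 : √2 * √2 = 2 := Real.mul_self_sqrt (by norm_num)
  have rlo : (1.4 : ℝ) < √2 := by rw [Real.lt_sqrt] <;> norm_num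
  have rhi : √2 < (1.5 : ℝ) := by rw [Real.sqrt_lt] <;> norm_num
  -- This `α` solves `1 / α - 1 = 1 + 1 / (1 - α)`, the balance of the two families.
  obtain ⟨α, hα⟩ : ∃ α : ℝ, α = 1 - √2 / 2 := ⟨_, rfl⟩
  have hα0 : 0 < α := by rw [hα]; linarith
  have hα1 : α < 1 := by rw [hα]; linarith
  have e1 : 1 / α - 1 - 0 = 1 + √2 := by
    have : (2 + √2) * α = 1 := by rw [hα]; linear_combination (-1 / 2) * r2
    rw [← eq_div_of_mul_eq hα0.ne' this]; ring
  have e2 : 1 + 1 / (1 - α) = 1 + √2 := by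
    have : √2 * (1 - α) = 1 := by rw [hα]; linear_combination (1 / 2) * r2
    have h : 1 - α ≠ 0 := by linarith
    rw [← eq_div_of_mul_eq h this]
  let k : ℕ → ℕ := fun n => ⌊α * n⌋₊
  have hinv : Tendsto (fun n : ℕ => 1 / ((n : ℝ) + 1)) atTop (𝓝 0) :=
    tendsto_one_div_add_atTop_nhds_zero_nat
  have hkn : Tendsto (fun n : ℕ => (k n : ℝ) / n) atTop (𝓝 α) :=
    (tendsto_nat_floor_mul_div_atTop hα0.le).comp tendsto_natCast_atTop_atTop
  have hnn : Tendsto (fun n : ℕ => (n : ℝ) / (n + 1)) atTop (𝓝 1) :=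
    tendsto_natCast_div_add_atTop 1
  have hkN : Tendsto (fun n : ℕ => (k n : ℝ) / (n + 1)) atTop (𝓝 α) := by
    have := hkn.mul hnn
    rw [mul_one] at this
    refine this.congr' ?_
    filter_upwards [eventually_gt_atTop 0] with n hn
    have : (n : ℝ) ≠ 0 := by exact_mod_cast hn.ne'
    field_simp
  have t1 : Tendsto (fun n : ℕ => ((n : ℝ) + 1) / (k n + 1)) atTop (𝓝 (1 / α)) := by
    have := (tendsto_const_nhds (x := (1 : ℝ))).div (hkN.add hinv) (by simpa using hα0.ne')
    rw [add_zero] at this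
    refine this.congr fun n => ?_
    have : (n : ℝ) + 1 ≠ 0 := by positivity
    simp only [Pi.div_apply]
    rw [← add_div, one_div_div]
  have t2 : Tendsto (fun n : ℕ => ((n : ℝ) + 1) / (n + 1 - k n)) atTop (𝓝 (1 / (1 - α))) := by
    have := (tendsto_const_nhds (x := (1 : ℝ))).div
      ((tendsto_const_nhds (x := (1 : ℝ))).sub hkN) (by linarith)
    refine this.congr fun n => ?_
    have : (0 : ℝ) < n + 1 := by positivity
    simp only [Pi.div_apply]
    rw [div_sub_eq this]
  have tA : Tendsto (fun n : ℕ => ((n : ℝ) + 1) / (k n + 1) - 1 - 1 / n) atTop (𝓝 (1 + √2)) := by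
    rw [← e1]
    exact (t1.sub_const 1).sub tendsto_one_div_atTop_nhds_zero_nat
  have tB : Tendsto (fun n : ℕ => 1 + ((n : ℝ) + 1) / (n + 1 - k n)) atTop (𝓝 (1 + √2)) := by
    rw [← e2]
    exact t2.const_add 1
  refine ⟨_, (min_self (1 + √2)) ▸ tA.min tB, ?_⟩
  have u1 := t1.eventually_lt_const (show 1 / α < 1 / α + 1 by linarith)
  have u2 := t2.eventually_lt_const (show 1 / (1 - α) < 1 / (1 - α) + 1 by linarith)
  have u3 := tB.eventually_lt_const (show 1 + √2 < 1 + √2 + 1 by linarith)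
  -- The first bound makes `k n` positive; the second makes the third class, of mass `n - O(1)`,
  -- heavy enough.
  have hbig := tendsto_natCast_atTop_atTop (R := ℝ)
    |>.eventually_ge_atTop (max (1 / α) (1 / α + 1 / (1 - α) + 10))
  filter_upwards [u1, u2, u3, hbig, eventually_gt_atTop 0] with n h1 h2 h3 h4 hn
  have hn' : (0 : ℝ) < n := by exact_mod_cast hn
  have hk1 : 1 ≤ k n := by
    refine Nat.le_floor ?_
    have := (le_max_left _ _).trans h4
    rw [div_le_iff₀ hα0] at this
    push_cast
    linarith
  have hkn' : k n < n := by
    have h5 : (k n : ℝ) ≤ α * n := Nat.floor_le (by positivity)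
    have : (k n : ℝ) < n := by nlinarith
    exact_mod_cast this
  have h6 := (le_max_right _ _).trans h4
  refine le_G_and_le_GPartial hk1 hkn' (min_le_left _ _) (min_le_right _ _) ?_
  refine (min_le_right _ _).trans ?_
  linarith

end RainbowBoolean

theorem theorem4p6 :
    (∀ n : ℕ, 18 ≤ n → RainbowBoolean.F n 3 = RainbowBoolean.FPartial n 2) ∧
    Filter.Tendsto (fun n : ℕ => RainbowBoolean.G n 3) Filter.atTop (nhds (1 + Real.sqrt 2)) ∧
    Filter.Tendsto (fun n : ℕ => RainbowBoolean.GPartial n 2) Filter.atTop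
      (nhds (1 + Real.sqrt 2)) := by
  obtain ⟨L, hL, hle⟩ := RainbowBoolean.exists_tendsto_lower_bound
  refine ⟨fun n hn => RainbowBoolean.F_eq_FPartial hn, ?_, ?_⟩
  · refine tendsto_of_tendsto_of_tendsto_of_le_of_le' hL tendsto_const_nhds
      (hle.mono fun n h => h.1) ?_
    filter_upwards [Filter.eventually_ge_atTop 100000] with n hn
    exact RainbowBoolean.G_le hn
  · refine tendsto_of_tendsto_of_tendsto_of_le_of_le' hL tendsto_const_nhds
      (hle.mono fun n h => h.2) ?_
    filter_upwards [Filter.eventually_ge_atTop 100] with n hn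
    exact RainbowBoolean.GPartial_le hn
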